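/- Let $\widehat f(\xi)=\int_{\mathbb R^5}f(x)e^{-ix\cdot\xi}\,dx$ denote the Fourier transform on $\mathbb R^5$, extended to $L^2(\mathbb R^5)$. Let $s>0$ and $\phi_s(r)=\sqrt{s^2+r^2}$. For a function $m$ on $[0,\infty)$ let $m(\sqrt{-\Delta})$ be the Fourier multiplier operator given by $\widehat{m(\sqrt{-\Delta})f}(\xi)=m(|\xi|)\widehat f(\xi)$; this defines in particular $\phi_s(\sqrt{-\Delta})$, $\phi_s(\sqrt{-\Delta})^{1/2}$ and the Klein--Gordon propagator $e^{it\phi_s(\sqrt{-\Delta})}$, $t\in\mathbb R$. For $f\in L^2(\mathbb R^5)$ with $\phi_s(\sqrt{-\Delta})f\in L^2(\mathbb R^5)$ (that is, $f\in H^1(\mathbb R^5)$) define $\|f\|_{(s)}\ge 0$ by $$\|f\|_{(s)}^4=\|\phi_s(\sqrt{-\Delta})f\|_{L^2(\mathbb R^5)}^4-s^2\|\phi_s(\sqrt{-\Delta})^{1/2}f\|_{L^2(\mathbb R^5)}^4 .$$ Let $(g_n)_{n\ge1}$ be a maximising sequence for the sharp inequality $$\|e^{it\phi_s(\sqrt{-\Delta})}f\|_{L^4(\mathbb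 R^{5+1})}\le\Big(\frac1{24\pi^2}\Big)^{1/4}\|f\|_{(s)},$$ that is, a sequence of functions in $H^1(\mathbb R^5)$ with $\|g_n\|_{(s)}\le 1$ for all $n$ and $$\|e^{it\phi_s(\sqrt{-\Delta})}g_n\|_{L^4(\mathbb R^{5+1})}\to\Big(\frac1{24\pi^2}\Big)^{1/4}\quad\text{as } n\to\infty .$$ Then for all $\varepsilon,R>0$ there exists $N\in\mathbb N$ such that for every $n\ge N$ $$\|\phi_s(\sqrt{-\Delta})^{1/2}g_n\|_{L^2(\mathbb R^5)}<\varepsilon\qquad\text{and}\qquad \big\|\widehat{\phi_s(\sqrt{-\Delta})g_n}\big\|_{L^2(B(0,R))}<\varepsilon ,$$ where $B(0,R)$ is the ball of radius $R$ centred at the origin in $\mathbb R^5$. -/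

import Mathlib

open MeasureTheory Filter Topology FourierTransform
open scoped ENNReal

namespace KleinGordon

noncomputable section

/-- The Euclidean space `ℝ⁵`. -/
abbrev R5 : Type := EuclideanSpace ℝ (Fin 5)

/-- The complex Hilbert space `L²(ℝ⁵)`. -/
abbrev L2 : Type := Lp ℂ 2 (volume : Measure R5)

/-- The spatial Fourier transform `f̂(ξ) = ∫ f(x) e^{-i x·ξ} dx`, extended to `L²(ℝ⁵)`.
Mathlib's `𝓕` (a unitary operator of `L²`) has the kernel `e^{-2πi x·ξ}`, so
`f̂(ξ) = 𝓕 f (ξ / 2π)`. -/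
def hat (f : L2) : R5 → ℂ := fun ξ => (𝓕 f : L2) ((2 * Real.pi)⁻¹ • ξ)

/-- The function `ξ ↦ m(|ξ|) f̂(ξ)`, written in the frequency variable of `𝓕`. -/
def symbolMul (m : ℝ → ℂ) (f : L2) : R5 → ℂ :=
  fun ξ => m (2 * Real.pi * ‖ξ‖) * (𝓕 f : L2) ξ

/-- `f` lies in the domain of `m(√-Δ)` on `L²(ℝ⁵)`. -/
def InDomain (m : ℝ → ℂ) (f : L2) : Prop := MemLp (symbolMul m f) 2 volume

open Classical in
/-- The operator `m(√-Δ)` on `L²(ℝ⁵)`: the Fourier multiplier that takes `f̂(ξ)` to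
`m(|ξ|) f̂(ξ)`. Outside its domain it is set to `0`. -/
def funcSqrtLaplacian (m : ℝ → ℂ) (f : L2) : L2 :=
  if h : InDomain m f then 𝓕⁻ (MemLp.toLp (symbolMul m f) h) else 0

/-- `φ_s(r) = √(s² + r²)`. -/
def phi (s r : ℝ) : ℝ := Real.sqrt (s ^ 2 + r ^ 2)

/-- The operator `φ_s(√-Δ)`. -/
def phiOp (s : ℝ) (f : L2) : L2 := funcSqrtLaplacian (fun r => (phi s r : ℂ)) f

/-- The operator `φ_s(√-Δ)^{1/2}`. -/
def phiHalfOp (s : ℝ) (f : L2) : L2 :=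
  funcSqrtLaplacian (fun r => ((phi s r ^ (1 / 2 : ℝ) : ℝ) : ℂ)) f

/-- The Klein--Gordon propagator `e^{itφ_s(√-Δ)}`. -/
def propagator (s t : ℝ) (f : L2) : L2 :=
  funcSqrtLaplacian (fun r => Complex.exp (Complex.I * (t * phi s r : ℝ))) f

/-- The space-time norm `‖e^{itφ_s(√-Δ)} f‖_{L⁴(ℝ⁵⁺¹)} = (∫_ℝ ‖e^{itφ_s(√-Δ)} f‖⁴_{L⁴(ℝ⁵)} dt)^{1/4}`. -/
def spaceTimeL4 (s : ℝ) (f : L2) : ℝ≥0∞ :=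
  (∫⁻ t : ℝ, eLpNorm (propagator s t f) 4 volume ^ 4) ^ (1 / 4 : ℝ)

/-- `‖f‖_{(s)}`, where `‖f‖_{(s)}⁴ = ‖φ_s(√-Δ) f‖⁴ - s² ‖φ_s(√-Δ)^{1/2} f‖⁴`. -/
def sNorm (s : ℝ) (f : L2) : ℝ :=
  (‖phiOp s f‖ ^ 4 - s ^ 2 * ‖phiHalfOp s f‖ ^ 4) ^ (1 / 4 : ℝ)

/-- The sharp constant `(1 / (24π²))^{1/4}`. -/
def sharpConst : ℝ := (1 / (24 * Real.pi ^ 2)) ^ (1 / 4 : ℝ)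

/-- `(g_n)` is a maximising sequence for `‖e^{itφ_s(√-Δ)} f‖_{L⁴} ≤ (1/(24π²))^{1/4} ‖f‖_{(s)}`,
among the functions `f` with `φ_s(√-Δ) f ∈ L²`. -/
def IsMaximisingSequence (s : ℝ) (g : ℕ → L2) : Prop :=
  (∀ n, InDomain (fun r => (phi s r : ℂ)) (g n)) ∧
  (∀ n, sNorm s (g n) ≤ 1) ∧
  Tendsto (fun n => spaceTimeL4 s (g n)) atTop (𝓝 (ENNReal.ofReal sharpConst))

end

end KleinGordon

namespace KleinGordon

/-! The square of a Klein–Gordon wave is the Fourier transform of `F ⊗ F` carried from `ℝ⁵ × ℝ⁵` to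
`ℝ⁵⁺¹` by adding two points of the hyperboloid `(φ_s(|ξ|), ξ)`. Duality, Cauchy–Schwarz and
Plancherel bound its `L²` norm by `|F(y)|²|F(z)|²` integrated against the density of this map
(`lintegral_enorm_sq_extensionOp_le`, `spaceTimeFour_le`). In dimension five the density is
explicit: the weight is `1/(24π²)` times `K(y,z) = φ_s(|y|)φ_s(|z|)(φ_s(|y|)φ_s(|z|) - y·z - s²)`
times `√(A/(A+4s²))`, where `A + 4s² = (φ_s(|y|)+φ_s(|z|))² - |y+z|²` is the squared invariant mass.
Expanding `K` and discarding the square of the total momentum leaves at most `‖f‖_(s)⁴`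
(`pairEnergy_le`), which is the sharp inequality.

The discarded factor `√(A/(A+4s²))` is bounded away from `1` on bounded frequencies. A maximising
sequence therefore has vanishing `K`-energy there, and its low-frequency part tends to zero in `L⁴`
of space-time (`tendsto_spaceTimeL4_low`). This does not by itself make the low-frequency `L²`
energy small, since `K` vanishes on the diagonal. But the high-frequency part must then carry almost
the whole space-time norm, so its energy is almost at least `1`. The constraint `‖g_n‖_(s) ≤ 1`
leaves no room for further mass: the cross term between low mass and high energy forces `∫
φ_s|ĝ_n|²` to zero (`mass_le`). On a ball `φ_s²` is at most a constant times `φ_s`, so both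
conclusions follow. -/

/-- The Fourier transform of the image of the complex measure `G ν` under `Φ`. -/
noncomputable def extensionOp {V : Type*} [NormedAddCommGroup V] [InnerProductSpace ℝ V]
    {Y : Type*} [MeasurableSpace Y] (ν : Measure Y) (Φ : Y → V) (G : Y → ℂ) (w : V) : ℂ :=
  ∫ p, Real.fourierChar (inner ℝ w (Φ p)) • G p ∂ν

theorem continuous_fourierChar_coe :
    Continuous fun x : ℝ => ((Real.fourierChar x : Circle) : ℂ) := by
  simp only [Real.fourierChar_apply]
  fun_prop

theorem norm_extensionOp_le {V : Type*} [NormedAddCommGroup V] [InnerProductSpace ℝ V]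
    {Y : Type*} [MeasurableSpace Y] {ν : Measure Y} (Φ : Y → V) (G : Y → ℂ) (w : V) :
    ‖extensionOp ν Φ G w‖ ≤ ∫ p, ‖G p‖ ∂ν := by
  refine (norm_integral_le_integral_norm _).trans_eq ?_
  simp

/-! ### Weighted `L²` bounds for Fourier transforms of image measures -/

section Fourier

variable {V : Type*} [NormedAddCommGroup V] [InnerProductSpace ℝ V] [FiniteDimensional ℝ V]
  [MeasurableSpace V] [BorelSpace V]

/-- On `L¹ ∩ L²` the `L²` inverse Fourier transform is given by the Fourier integral. -/
theorem fourierInv_toLp_ae_eq {F : V → ℂ} (h1 : Integrable F) (h2 : MemLp F 2) :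
    ((𝓕⁻ (h2.toLp F) : Lp ℂ 2 (volume : Measure V)) : V → ℂ) =ᵐ[volume] 𝓕⁻ F := by
  have hcont : Continuous (𝓕⁻ F) := by
    have : Continuous fun w : V => 𝓕 F (-w) :=
      (VectorFourier.fourierIntegral_continuous Real.continuous_fourierChar
        (L := innerₗ V) continuous_inner h1).comp continuous_neg
    simpa only [← Real.fourierInv_eq_fourier_neg] using this
  apply ae_eq_of_integral_contDiff_smul_eq
  · exact (Lp.memLp _).locallyIntegrable (by norm_num)
  · exact hcont.locallyIntegrable
  -- Both sides are compared as distributions: the `L²` transform is moved onto the test function by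
  -- definition, and Fubini moves it back onto `F`.
  · intro g hg hgc
    have hg₁ : HasCompactSupport (Complex.ofRealCLM ∘ g) := hgc.comp_left rfl
    have hg₂ : ContDiff ℝ (⊤ : ℕ∞) (Complex.ofRealCLM ∘ g) := by fun_prop
    set G := hg₁.toSchwartzMap hg₂ with hG
    have e1 := congrArg (fun T => T G) (Lp.fourierInv_toTemperedDistribution_eq (h2.toLp F))
    simp only [TemperedDistribution.fourierInv_apply, Lp.toTemperedDistribution_apply] at e1
    have e2 : ∫ x, (𝓕⁻ G) x • (h2.toLp F) x = ∫ x, (𝓕⁻ (G : V → ℂ)) x • F x := by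
      rw [SchwartzMap.fourierInv_coe]
      apply integral_congr_ae
      filter_upwards [h2.coeFn_toLp] with x hx
      rw [hx]
    have e3 : ∫ x, (𝓕⁻ (G : V → ℂ)) x • F x = ∫ x, G x • 𝓕⁻ F x := by
      have := VectorFourier.integral_fourierIntegral_smul_eq_flip (L := -innerₗ V)
        (μ := (volume : Measure V)) (ν := (volume : Measure V))
        Real.continuous_fourierChar (by simpa using! continuous_inner.neg) G.integrable h1
      convert! this using 3
      simp only [Real.fourierInv_eq, VectorFourier.fourierIntegral]
      simp [real_inner_comm]
    have e4 : ∀ x, g x • 𝓕⁻ F x = G x • 𝓕⁻ F x := fun x => by simp [hG]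
    have e5 : ∀ x, g x • (𝓕⁻ (h2.toLp F) : Lp ℂ 2 (volume : Measure V)) x
        = G x • (𝓕⁻ (h2.toLp F) : Lp ℂ 2 (volume : Measure V)) x := fun x => by simp [hG]
    simp_rw [e4, e5]
    rw [← e1, e2, e3]

theorem lintegral_enorm_sq_fourierInv {F : V → ℂ} (h1 : Integrable F) (h2 : MemLp F 2) :
    ∫⁻ w, ‖𝓕⁻ F w‖ₑ ^ 2 = ∫⁻ w, ‖F w‖ₑ ^ 2 := by
  have key : ∀ f : V → ℂ, eLpNorm f 2 volume ^ 2 = ∫⁻ w, ‖f w‖ₑ ^ 2 := fun f => by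
    simpa using eLpNorm_nnreal_pow_eq_lintegral (f := f) (μ := volume) (p := 2) (by norm_num)
  rw [← key, ← key, ← eLpNorm_congr_ae (fourierInv_toLp_ae_eq h1 h2),
    ← eLpNorm_congr_ae h2.coeFn_toLp, ← Lp.enorm_def, ← Lp.enorm_def]
  congr 1
  have : ‖(𝓕⁻ (h2.toLp F) : Lp ℂ 2 (volume : Measure V))‖ = ‖h2.toLp F‖ :=
    (Lp.fourierTransformₗᵢ V ℂ).symm.norm_map _
  rw [← ofReal_norm, ← ofReal_norm, this]

variable {Y : Type*} [MeasurableSpace Y] {ν : Measure Y}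

theorem continuous_extensionOp {Φ : Y → V} (hΦ : Measurable Φ) {G : Y → ℂ} (hG : Integrable G ν) :
    Continuous (extensionOp ν Φ G) := by
  refine continuous_of_dominated (bound := fun p => ‖G p‖) (fun w => ?_) (fun w => ?_) hG.norm ?_
  · simp only [Circle.smul_def]
    refine AEStronglyMeasurable.fun_smul ?_ hG.1
    exact (continuous_fourierChar_coe.measurable.comp
      (measurable_const.inner hΦ)).aestronglyMeasurable
  · simp
  · refine ae_of_all _ fun p => ?_
    refine Continuous.fun_smul ?_ continuous_const
    exact Real.continuous_fourierChar.comp (continuous_id.inner continuous_const)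

/-- Absorption of a square root. For `Q ≠ 0` the hypothesis holds trivially when `I = ∞`, which is
why the duality argument below works on balls first. -/
theorem le_of_le_sqrt_mul_sqrt {I Q : ℝ≥0∞} (hI : I ≠ ∞)
    (h : I ≤ Q ^ (1 / 2 : ℝ) * I ^ (1 / 2 : ℝ)) : I ≤ Q := by
  rcases eq_or_ne I 0 with h0 | h0
  · simp [h0]
  have h1 : I = I ^ (1 / 2 : ℝ) * I ^ (1 / 2 : ℝ) := by
    rw [← ENNReal.rpow_add _ _ h0 hI]; norm_num
  have h2 : I ^ (1 / 2 : ℝ) ≠ 0 := by simp [h0, hI]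
  have h3 : I ^ (1 / 2 : ℝ) ≠ ∞ := by simp [h0, hI]
  have h4 : I ^ (1 / 2 : ℝ) ≤ Q ^ (1 / 2 : ℝ) := by
    rw [h1] at h
    rw [← h1] at h
    refine (ENNReal.mul_le_mul_iff_left h2 h3).1 ?_
    rwa [← h1]
  exact (ENNReal.rpow_le_rpow_iff (by norm_num)).1 h4

/-- Weighted `L²` bound for the Fourier transform of an image measure, from a bound for the
density of the image of `κ⁻¹ ν`. -/
theorem lintegral_enorm_sq_extensionOp_le [SigmaFinite ν] {Φ : Y → V} (hΦ : Measurable Φ) {G : Y → ℂ}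
    (hG : Integrable G ν) {κ : Y → ℝ≥0∞} (hκ : Measurable κ) (hκ0 : ∀ᵐ p ∂ν, κ p ≠ 0)
    (hκt : ∀ p, κ p ≠ ∞)
    (hB : ∀ B : V → ℝ≥0∞, Measurable B → ∫⁻ p, B (Φ p) * (κ p)⁻¹ ∂ν ≤ ∫⁻ w, B w) :
    ∫⁻ w, ‖extensionOp ν Φ G w‖ₑ ^ 2 ≤ ∫⁻ p, ‖G p‖ₑ ^ 2 * κ p ∂ν := by
  set u := extensionOp ν Φ G with hu
  have huc : Continuous u := continuous_extensionOp hΦ hG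
  set Q := ∫⁻ p, ‖G p‖ₑ ^ 2 * κ p ∂ν with hQ
  have main : ∀ n : ℕ, ∫⁻ w in Metric.closedBall (0 : V) n, ‖u w‖ₑ ^ 2 ≤ Q := by
    intro n
    set D := Metric.closedBall (0 : V) (n : ℝ) with hD
    have hDm : MeasurableSet D := Metric.isClosed_closedBall.measurableSet
    have hDv : volume D < ∞ := measure_closedBall_lt_top
    -- The dual function is `u` itself, conjugated and cut off to a ball; being bounded with bounded
    -- support, it lies in `L¹ ∩ L²`.
    set A : V → ℂ := D.indicator fun w => (starRingEnd ℂ) (u w) with hA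
    have hAm : AEStronglyMeasurable A volume :=
      (huc.star.aestronglyMeasurable).indicator hDm
    have hAb : MemLp A ∞ volume := by
      refine memLp_top_of_bound hAm (∫ p, ‖G p‖ ∂ν) (ae_of_all _ fun w => ?_)
      by_cases hw : w ∈ D
      · simpa [hA, hw] using norm_extensionOp_le Φ G w
      · simpa [hA, hw] using integral_nonneg fun p => norm_nonneg (G p)
    have hAs : ∀ w, w ∉ D → A w = 0 := fun w hw => by simp [hA, hw]
    have h2 : MemLp A 2 := by
      exact hAb.mono_exponent_of_measure_support_ne_top hAs hDv.ne le_top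
    have h1 : Integrable A := memLp_one_iff_integrable.1
      (hAb.mono_exponent_of_measure_support_ne_top hAs hDv.ne le_top)
    have hI : ∫⁻ w in D, ‖u w‖ₑ ^ 2 = ∫⁻ w, ‖A w‖ₑ ^ 2 := by
      rw [← lintegral_indicator hDm]
      refine lintegral_congr fun w => ?_
      by_cases hw : w ∈ D
      · simp [hA, hw]
      · simp [hA, hw]
    have hIfin : ∫⁻ w, ‖A w‖ₑ ^ 2 ≠ ∞ := by
      have := h2.eLpNorm_lt_top
      have e : eLpNorm A 2 volume ^ 2 = ∫⁻ w, ‖A w‖ₑ ^ 2 := by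
        simpa using eLpNorm_nnreal_pow_eq_lintegral (f := A) (μ := volume) (p := 2) (by norm_num)
      rw [← e]
      exact (ENNReal.pow_lt_top this).ne
    have hdual : ∫ w, A w * u w = ∫ p, G p * 𝓕⁻ A (Φ p) ∂ν := by
      have : ∀ w, A w * u w = ∫ p, A w * (Real.fourierChar (inner ℝ w (Φ p)) • G p) ∂ν :=
        fun w => by rw [integral_const_mul]; rfl
      simp_rw [this]
      rw [integral_integral_swap]
      · refine integral_congr_ae (ae_of_all _ fun p => ?_)
        simp only [Real.fourierInv_eq]
        rw [← integral_const_mul]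
        refine integral_congr_ae (ae_of_all _ fun w => ?_)
        simp only [Circle.smul_def, smul_eq_mul]
        ring
      · have hint : Integrable (fun q : V × Y => A q.1 * G q.2) (volume.prod ν) := h1.mul_prod hG
        refine (hint.bdd_mul (c := 1)
          (f := fun q : V × Y => ((Real.fourierChar (inner ℝ q.1 (Φ q.2)) : Circle) : ℂ)) ?_ ?_).congr ?_
        · refine Measurable.aestronglyMeasurable ?_
          have : Measurable fun q : V × Y => (inner ℝ q.1 (Φ q.2) : ℝ) :=
            measurable_fst.inner (hΦ.comp measurable_snd)
          exact continuous_fourierChar_coe.measurable.comp this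
        · exact ae_of_all _ fun q => (Circle.norm_coe _).le
        · refine ae_of_all _ fun q => ?_
          simp only [Function.uncurry, Circle.smul_def, smul_eq_mul]
          ring
    have hself : ‖∫ w, A w * u w‖ₑ = ∫⁻ w, ‖A w‖ₑ ^ 2 := by
      have e1 : ∀ w, A w * u w = ((‖A w‖ ^ 2 : ℝ) : ℂ) := fun w => by
        by_cases hw : w ∈ D
        · simp [hA, hw, Complex.conj_mul']
        · simp [hA, hw]
      simp_rw [e1]
      rw [integral_complex_ofReal]
      have e2 : 0 ≤ ∫ w, ‖A w‖ ^ 2 := integral_nonneg fun w => by positivity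
      rw [← ofReal_norm, Complex.norm_real, Real.norm_of_nonneg e2,
        ofReal_integral_eq_lintegral_ofReal (h2.integrable_norm_pow (by norm_num)) (ae_of_all _ fun w => by
          positivity)]
      refine lintegral_congr fun w => ?_
      rw [← ofReal_norm, ENNReal.ofReal_pow (norm_nonneg _)]
    have hAF : Measurable fun w => ‖𝓕⁻ A w‖ₑ := by
      have : Continuous fun w : V => 𝓕 A (-w) :=
        (VectorFourier.fourierIntegral_continuous Real.continuous_fourierChar
          (L := innerₗ V) continuous_inner h1).comp continuous_neg
      simp only [← Real.fourierInv_eq_fourier_neg] at this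
      exact this.enorm.measurable
    -- Cauchy–Schwarz with the weight split as `κ^{1/2} κ^{-1/2}`; the second factor is controlled
    -- by `hB` for `B = |𝓕⁻ A|²`, followed by Plancherel.
    have hcs : ‖∫ p, G p * 𝓕⁻ A (Φ p) ∂ν‖ₑ
        ≤ Q ^ (1 / 2 : ℝ) * (∫⁻ w, ‖A w‖ₑ ^ 2) ^ (1 / 2 : ℝ) := by
      refine (enorm_integral_le_lintegral_enorm _).trans ?_
      have hsq : ∀ x : ℝ≥0∞, (x ^ (1 / 2 : ℝ)) ^ (2 : ℝ) = x := fun x => by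
        rw [← ENNReal.rpow_mul]; norm_num
      calc ∫⁻ p, ‖G p * 𝓕⁻ A (Φ p)‖ₑ ∂ν
          = ∫⁻ p, ((fun p => ‖G p‖ₑ * (κ p) ^ (1 / 2 : ℝ)) *
              fun p => ‖𝓕⁻ A (Φ p)‖ₑ * ((κ p)⁻¹) ^ (1 / 2 : ℝ)) p ∂ν := by
            refine lintegral_congr_ae ?_
            filter_upwards [hκ0] with p hp
            simp only [Pi.mul_apply, enorm_mul]
            rw [mul_mul_mul_comm, ← ENNReal.mul_rpow_of_nonneg _ _ (by norm_num : (0:ℝ) ≤ 1 / 2),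
              ENNReal.mul_inv_cancel hp (hκt p)]
            simp
        _ ≤ _ := ENNReal.lintegral_mul_le_Lp_mul_Lq ν Real.HolderConjugate.two_two
              (hG.1.enorm.mul (hκ.pow_const _).aemeasurable)
              ((hAF.comp hΦ).mul (hκ.inv.pow_const _)).aemeasurable
        _ ≤ _ := by
            refine mul_le_mul' (le_of_eq ?_) ?_
            · rw [hQ]
              congr 1
              refine lintegral_congr fun p => ?_
              rw [ENNReal.mul_rpow_of_nonneg _ _ (by norm_num), hsq]
              norm_num
            · gcongr
              rw [← lintegral_enorm_sq_fourierInv h1 h2]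
              refine le_trans (le_of_eq ?_) (hB (fun w => ‖𝓕⁻ A w‖ₑ ^ 2) (hAF.pow_const _))
              refine lintegral_congr fun p => ?_
              rw [ENNReal.mul_rpow_of_nonneg _ _ (by norm_num), hsq]
              norm_num
    rw [hI]
    refine le_of_le_sqrt_mul_sqrt hIfin ?_
    rw [← hdual, hself] at hcs
    exact hcs
  have hmono : Monotone fun n : ℕ => Metric.closedBall (0 : V) (n : ℝ) := fun a b hab =>
    Metric.closedBall_subset_closedBall (by exact_mod_cast hab)
  have huniv : ⋃ n : ℕ, Metric.closedBall (0 : V) (n : ℝ) = Set.univ :=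
    Metric.iUnion_closedBall_nat 0
  rw [← setLIntegral_univ, ← huniv,
    setLIntegral_iUnion_of_directed _ (directed_of_isDirected_le hmono)]
  exact iSup_le main

end Fourier

/-! ### The density of two-particle energies in cylindrical coordinates -/

section Density

theorem lintegral_comp_norm_eq {E : Type*} [NormedAddCommGroup E] [NormedSpace ℝ E]
    [MeasurableSpace E] [BorelSpace E] [Nontrivial E] [FiniteDimensional ℝ E]
    (μ : Measure E) [μ.IsAddHaarMeasure] {f : ℝ → ℝ≥0∞} (hf : Measurable f) :
    ∫⁻ x, f ‖x‖ ∂μ = (Module.finrank ℝ E * μ (Metric.ball 0 1)) *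
      ∫⁻ r in Set.Ioi (0 : ℝ), ENNReal.ofReal (r ^ (Module.finrank ℝ E - 1)) * f r := by
  calc ∫⁻ x, f ‖x‖ ∂μ
      = ∫⁻ x : ({(0)}ᶜ : Set E), f ‖x.1‖ ∂(μ.comap (↑)) := by
        rw [lintegral_subtype_comap (measurableSet_singleton _).compl fun x ↦ f (‖x‖),
          restrict_compl_singleton]
    _ = ∫⁻ x, f x.2 ∂μ.toSphere.prod (.volumeIoiPow (Module.finrank ℝ E - 1)) := by
        simpa using μ.measurePreserving_homeomorphUnitSphereProd.lintegral_comp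
          (f := fun q => f (q.2 : ℝ)) (hf.comp (measurable_subtype_coe.comp measurable_snd))
    _ = μ.toSphere Set.univ *
          ∫⁻ x : Set.Ioi (0 : ℝ), f x ∂.volumeIoiPow (Module.finrank ℝ E - 1) := by
        have h := lintegral_prod_mul (μ := μ.toSphere)
          (ν := Measure.volumeIoiPow (Module.finrank ℝ E - 1)) (f := fun _ => 1)
          (g := fun x : Set.Ioi (0 : ℝ) => f x)
          aemeasurable_const (hf.comp measurable_subtype_coe).aemeasurable
        simpa using h
    _ = _ := by
        rw [μ.toSphere_apply_univ, Measure.volumeIoiPow,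
          lintegral_withDensity_eq_lintegral_mul _ (by fun_prop)
            (show Measurable fun x : Set.Ioi (0 : ℝ) => f x from hf.comp measurable_subtype_coe)]
        congr 1
        rw [← lintegral_subtype_comap measurableSet_Ioi]
        rfl

theorem lintegral_comp_norm_euclideanSpace_four {f : ℝ → ℝ≥0∞} (hf : Measurable f) :
    ∫⁻ z : EuclideanSpace ℝ (Fin 4), f ‖z‖ =
      ENNReal.ofReal (2 * Real.pi ^ 2) *
        ∫⁻ r in Set.Ioi (0 : ℝ), ENNReal.ofReal (r ^ 3) * f r := by
  rw [lintegral_comp_norm_eq volume hf]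
  congr 1
  · rw [EuclideanSpace.volume_ball]
    have h3 : Real.Gamma ((4 : ℝ) / 2 + 1) = 2 := by
      rw [show (4 : ℝ) / 2 + 1 = (2 : ℕ) + 1 by norm_num, Real.Gamma_nat_eq_factorial]; norm_num
    have h4 : √Real.pi ^ 4 = Real.pi ^ 2 := by
      rw [show √Real.pi ^ 4 = (√Real.pi ^ 2) ^ 2 by ring, Real.sq_sqrt Real.pi_pos.le]
    simp only [finrank_euclideanSpace, Fintype.card_fin, Nat.cast_ofNat, h3, h4]
    rw [show (4 : ℝ≥0∞) = ENNReal.ofReal 4 by norm_num]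
    simp only [ENNReal.ofReal_one, one_pow, one_mul]
    rw [← ENNReal.ofReal_mul (by norm_num)]
    congr 1; ring
  · simp

/-- The density of the image of `dy / (E(y) E(ξ - y))` under `y ↦ E(y) + E(ξ - y)`, where
`E(y) = √(a² + |y|²)` on `ℝ⁵` and `c = |ξ|`. -/
noncomputable def pairDensity (a τ c : ℝ) : ℝ :=
  Real.pi ^ 2 / 3 * (τ ^ 2 - c ^ 2 - 4 * a ^ 2) * √(τ ^ 2 - c ^ 2 - 4 * a ^ 2) / √(τ ^ 2 - c ^ 2)

/-- The squared distance to the axis of the point of the ellipsoid of energy `τ` with first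
coordinate `x`. -/
noncomputable def ellipsoidRadiusSq (a τ c x : ℝ) : ℝ :=
  ((τ ^ 2 - c ^ 2 - 4 * a ^ 2) - (τ ^ 2 - c ^ 2) / τ ^ 2 * (2 * x - c) ^ 2) / 4

/-- With `τ = p + q`, the difference of the squares gives `p - q = c(2x - c)/τ`, and `2(p² + q²) =
τ² + (p - q)²` then determines `r²`. -/
theorem ellipsoidRadiusSq_add_sqrt {a x c r : ℝ} (ha : 0 < a) :
    ellipsoidRadiusSq a (√(a ^ 2 + x ^ 2 + r ^ 2) + √(a ^ 2 + (c - x) ^ 2 + r ^ 2)) c x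
      = r ^ 2 := by
  set p := √(a ^ 2 + x ^ 2 + r ^ 2) with hp
  set q := √(a ^ 2 + (c - x) ^ 2 + r ^ 2) with hq
  have hp0 : 0 < p := Real.sqrt_pos.2 (by positivity)
  have hq0 : 0 < q := Real.sqrt_pos.2 (by positivity)
  have hp2 : p ^ 2 = a ^ 2 + x ^ 2 + r ^ 2 := Real.sq_sqrt (by positivity)
  have hq2 : q ^ 2 = a ^ 2 + (c - x) ^ 2 + r ^ 2 := Real.sq_sqrt (by positivity)
  have hτ : p + q ≠ 0 := by positivity
  have key : c * (2 * x - c) = (p - q) * (p + q) := by nlinarith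
  have h1 : (((p + q) ^ 2 - c ^ 2) / (p + q) ^ 2 * (2 * x - c) ^ 2)
      = (2 * x - c) ^ 2 - (p - q) ^ 2 := by
    have : c ^ 2 * (2 * x - c) ^ 2 = (p - q) ^ 2 * (p + q) ^ 2 := by
      rw [← mul_pow, key, mul_pow]
    field_simp
    nlinarith
  rw [ellipsoidRadiusSq, h1]
  nlinarith

/-- With `y = c - x`, the difference `p²q² - (a² + xy - r²)²` equals `a²(x-y)² + r²(x+y)² + 4a²r²`.
Strictness keeps the energies in the region where `pairDensity` is positive. -/
theorem four_mul_sq_lt_of_add_sqrt {a x c r : ℝ} (ha : 0 < a) (hr : 0 < r) :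
    4 * a ^ 2 < (√(a ^ 2 + x ^ 2 + r ^ 2) + √(a ^ 2 + (c - x) ^ 2 + r ^ 2)) ^ 2 - c ^ 2 := by
  set p := √(a ^ 2 + x ^ 2 + r ^ 2) with hp
  set q := √(a ^ 2 + (c - x) ^ 2 + r ^ 2) with hq
  have hp0 : 0 < p := Real.sqrt_pos.2 (by positivity)
  have hq0 : 0 < q := Real.sqrt_pos.2 (by positivity)
  have hp2 : p ^ 2 = a ^ 2 + x ^ 2 + r ^ 2 := Real.sq_sqrt (by positivity)
  have hq2 : q ^ 2 = a ^ 2 + (c - x) ^ 2 + r ^ 2 := Real.sq_sqrt (by positivity)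
  have h : a ^ 2 + x * (c - x) - r ^ 2 < p * q := by
    refine lt_of_pow_lt_pow_left₀ 2 (by positivity) ?_
    rw [mul_pow, hp2, hq2]
    have : 0 < a ^ 2 * r ^ 2 := by positivity
    nlinarith [sq_nonneg (a * (x - (c - x))), sq_nonneg (r * (x + (c - x)))]
  nlinarith

/-- Substitution of the energy `τ = p + q` for the radius: `dτ = rτ/(pq) dr`, so `r³/(pq) dr =
(r²/τ) dτ`. Only containment of the image in the energy region is needed. -/
theorem lintegral_radius_le_lintegral_energy {a : ℝ} (ha : 0 < a) (x c : ℝ) (b : ℝ → ℝ≥0∞) :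
    ∫⁻ r in Set.Ioi (0 : ℝ), ENNReal.ofReal (r ^ 3) *
      (b (√(a ^ 2 + x ^ 2 + r ^ 2) + √(a ^ 2 + (c - x) ^ 2 + r ^ 2)) *
        ENNReal.ofReal (√(a ^ 2 + x ^ 2 + r ^ 2) * √(a ^ 2 + (c - x) ^ 2 + r ^ 2))⁻¹) ≤
    ∫⁻ τ in {τ : ℝ | 0 < τ ∧ 4 * a ^ 2 < τ ^ 2 - c ^ 2},
      b τ * ENNReal.ofReal (ellipsoidRadiusSq a τ c x / τ) := by
  set p : ℝ → ℝ := fun r => √(a ^ 2 + x ^ 2 + r ^ 2) with hp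
  set q : ℝ → ℝ := fun r => √(a ^ 2 + (c - x) ^ 2 + r ^ 2) with hq
  have hp0 : ∀ r, 0 < p r := fun r => Real.sqrt_pos.2 (by positivity)
  have hq0 : ∀ r, 0 < q r := fun r => Real.sqrt_pos.2 (by positivity)
  have hderiv : ∀ (k : ℝ) (_ : 0 < k) (r : ℝ),
      HasDerivAt (fun r => √(k + r ^ 2)) (r / √(k + r ^ 2)) r := by
    intro k hk r
    have h : HasDerivAt (fun r : ℝ => k + r ^ 2) (2 * r) r := by
      simpa using (hasDerivAt_pow 2 r).const_add k
    convert! h.sqrt (by positivity) using 1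
    field_simp
  set f : ℝ → ℝ := fun r => p r + q r with hf
  set f' : ℝ → ℝ := fun r => r / p r + r / q r with hf'
  have hfd : ∀ r, HasDerivAt f (f' r) r := fun r =>
    (hderiv (a ^ 2 + x ^ 2) (by positivity) r).add (hderiv (a ^ 2 + (c - x) ^ 2) (by positivity) r)
  have hmono : StrictMonoOn f (Set.Ioi 0) := by
    refine strictMonoOn_of_deriv_pos (convex_Ioi 0)
      (fun r _ => (hfd r).continuousAt.continuousWithinAt) fun r hr => ?_
    rw [interior_Ioi] at hr
    have hr : 0 < r := hr
    rw [(hfd r).deriv]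
    have := hp0 r
    have := hq0 r
    positivity
  set g : ℝ → ℝ≥0∞ := fun τ => b τ * ENNReal.ofReal (ellipsoidRadiusSq a τ c x / τ) with hg
  have hcv := lintegral_image_eq_lintegral_abs_deriv_mul measurableSet_Ioi
    (fun r _ => (hfd r).hasDerivWithinAt) hmono.injOn g
  calc _ = ∫⁻ r in Set.Ioi (0 : ℝ), ENNReal.ofReal |f' r| * g (f r) := by
        refine setLIntegral_congr_fun measurableSet_Ioi fun r hr => ?_
        have hr : 0 < r := hr
        have h1 := hp0 r
        have h2 := hq0 r
        have hf'0 : 0 ≤ f' r := by positivity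
        simp only [hg]
        rw [abs_of_nonneg hf'0, mul_left_comm, mul_left_comm (ENNReal.ofReal (f' r)),
          ← ENNReal.ofReal_mul (by positivity), ← ENNReal.ofReal_mul hf'0,
          show ellipsoidRadiusSq a (f r) c x = r ^ 2 from ellipsoidRadiusSq_add_sqrt ha]
        congr 2
        simp only [hf, hf']
        change r ^ 3 * (p r * q r)⁻¹ = _
        field_simp
        ring
    _ = ∫⁻ τ in f '' Set.Ioi 0, g τ := hcv.symm
    _ ≤ _ := by
        refine lintegral_mono_set ?_
        rintro _ ⟨r, hr, rfl⟩
        exact ⟨add_pos (hp0 r) (hq0 r), four_mul_sq_lt_of_add_sqrt ha hr⟩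

/-- In `x` the integrand is a concave parabola centred at `c/2`, and `ENNReal.ofReal` removes its
negative part. The factor `2π²` is the area of the unit sphere of `ℝ⁴`. -/
theorem lintegral_ellipsoidRadiusSq_le {a τ c : ℝ} (hτ : 0 < τ)
    (hA : 4 * a ^ 2 < τ ^ 2 - c ^ 2) :
    ENNReal.ofReal (2 * Real.pi ^ 2) *
      ∫⁻ x, ENNReal.ofReal (ellipsoidRadiusSq a τ c x / τ) ≤
    ENNReal.ofReal (pairDensity a τ c) := by
  set A := τ ^ 2 - c ^ 2 - 4 * a ^ 2 with hAdef
  set M := √(τ ^ 2 - c ^ 2) with hM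
  have hA0 : 0 < A := by linarith
  have hM0 : 0 < M := Real.sqrt_pos.2 (by nlinarith)
  have hM2 : M ^ 2 = τ ^ 2 - c ^ 2 := Real.sq_sqrt (by nlinarith)
  have hs2 : √A ^ 2 = A := Real.sq_sqrt hA0.le
  have hs0 : 0 < √A := Real.sqrt_pos.2 hA0
  -- The half-width of the interval on which the parabola is nonnegative.
  set w := √A * τ / (2 * M) with hw
  have hw0 : 0 < w := by positivity
  have hform : ∀ x, ellipsoidRadiusSq a τ c x / τ = (M ^ 2 / τ ^ 3) * (w ^ 2 - (x - c / 2) ^ 2) := by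
    intro x
    rw [ellipsoidRadiusSq, ← hAdef, ← hM2, hw, div_pow, mul_pow, hs2]
    field_simp
    ring
  have hint : ∫ x in (c / 2 - w)..(c / 2 + w), (M ^ 2 / τ ^ 3) * (w ^ 2 - (x - c / 2) ^ 2)
      = (M ^ 2 / τ ^ 3) * (4 / 3 * w ^ 3) := by
    rw [intervalIntegral.integral_const_mul]
    rw [intervalIntegral.integral_comp_sub_right (fun y => w ^ 2 - y ^ 2) (c / 2)]
    rw [intervalIntegral.integral_sub (by simp) (by simp), integral_pow]
    simp
    ring_nf
    simp
  have hle : ∫⁻ x, ENNReal.ofReal (ellipsoidRadiusSq a τ c x / τ)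
      ≤ ENNReal.ofReal ((M ^ 2 / τ ^ 3) * (4 / 3 * w ^ 3)) := by
    rw [← hint, intervalIntegral.integral_of_le (by linarith),
      ofReal_integral_eq_lintegral_ofReal]
    · rw [← lintegral_indicator measurableSet_Ioc]
      refine lintegral_mono_ae ?_
      have : ∀ᵐ x : ℝ, x ≠ c / 2 - w := by simp [ae_iff]
      filter_upwards [this] with x hx0
      rw [hform]
      by_cases hx : x ∈ Set.Ioc (c / 2 - w) (c / 2 + w)
      · simp [hx]
      · rw [ENNReal.ofReal_of_nonpos]
        · exact zero_le
        · refine mul_nonpos_of_nonneg_of_nonpos (by positivity) ?_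
          rw [Set.mem_Ioc, not_and_or, not_lt, not_le] at hx
          rcases hx with hx | hx <;> nlinarith
    · exact (by fun_prop : Continuous fun x : ℝ => (M ^ 2 / τ ^ 3) *
        (w ^ 2 - (x - c / 2) ^ 2)).integrableOn_Ioc
    · refine (ae_restrict_mem measurableSet_Ioc).mono fun x hx => ?_
      refine mul_nonneg (by positivity) ?_
      nlinarith [hx.1, hx.2]
  refine (mul_le_mul_right hle _).trans ?_
  rw [← ENNReal.ofReal_mul (by positivity)]
  refine ENNReal.ofReal_le_ofReal (le_of_eq ?_)
  rw [pairDensity, ← hAdef, ← hM, hw, div_pow, mul_pow, show √A ^ 3 = √A ^ 2 * √A by ring, hs2]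
  field_simp
  ring

end Density

/-! ### The sharp bilinear weight on pairs of points of the hyperboloid -/

section Pair

/-- Any isometry sends the axis vector to some vector of norm `‖ξ‖`; a reflection then moves that
vector to `ξ`. -/
theorem exists_linearIsometryEquiv_axis (ξ : R5) :
    ∃ T : WithLp 2 (ℝ × EuclideanSpace ℝ (Fin 4)) ≃ₗᵢ[ℝ] R5,
      T (WithLp.toLp 2 (‖ξ‖, 0)) = ξ := by
  have hfin : Module.finrank ℝ (WithLp 2 (ℝ × EuclideanSpace ℝ (Fin 4))) =
      Module.finrank ℝ R5 := by
    rw [(WithLp.linearEquiv 2 ℝ (ℝ × EuclideanSpace ℝ (Fin 4))).finrank_eq]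
    simp
  let U := (stdOrthonormalBasis ℝ (WithLp 2 (ℝ × EuclideanSpace ℝ (Fin 4)))).equiv
    (stdOrthonormalBasis ℝ R5) (finCongr hfin)
  set v := U (WithLp.toLp 2 (‖ξ‖, 0)) with hv
  have hn : ‖v‖ = ‖ξ‖ := by
    rw [hv, LinearIsometryEquiv.norm_map, WithLp.prod_norm_eq_of_L2]
    simp
  exact ⟨U.trans (Submodule.reflection (ℝ ∙ (v - ξ))ᗮ), by
    simpa [← hv] using! Submodule.reflection_sub hn⟩

theorem phi_pos {s : ℝ} (hs : 0 < s) (r : ℝ) : 0 < phi s r := Real.sqrt_pos.2 (by positivity)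

theorem phi_sq (s r : ℝ) : phi s r ^ 2 = s ^ 2 + r ^ 2 := Real.sq_sqrt (by positivity)

theorem continuous_phi (s : ℝ) : Continuous (phi s) := by
  unfold phi; fun_prop

theorem measurable_pairDensity (a : ℝ) : Measurable fun q : ℝ × ℝ => pairDensity a q.1 q.2 := by
  unfold pairDensity; fun_prop

/-- Both energies depend only on the coordinate of `y` along `ξ` and on the distance to that axis,
so the integral reduces to the two one-dimensional computations above. -/
theorem lintegral_comp_energy_le {a : ℝ} (ha : 0 < a) (ξ : R5) {b : ℝ → ℝ≥0∞}
    (hb : Measurable b) :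
    ∫⁻ y : R5, b (phi a ‖y‖ + phi a ‖ξ - y‖) * ENNReal.ofReal (phi a ‖y‖ * phi a ‖ξ - y‖)⁻¹ ≤
      ∫⁻ τ in {τ : ℝ | 0 < τ ∧ 4 * a ^ 2 < τ ^ 2 - ‖ξ‖ ^ 2},
        b τ * ENNReal.ofReal (pairDensity a τ ‖ξ‖) := by
  obtain ⟨T, hT⟩ := exists_linearIsometryEquiv_axis ξ
  set c := ‖ξ‖ with hc
  set S := {τ : ℝ | 0 < τ ∧ 4 * a ^ 2 < τ ^ 2 - c ^ 2} with hS
  have hSm : MeasurableSet S := by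
    apply MeasurableSet.inter
    · exact measurableSet_Ioi
    · exact measurableSet_lt (f := fun _ : ℝ => 4 * a ^ 2) (g := fun τ : ℝ => τ ^ 2 - c ^ 2)
        measurable_const (by fun_prop)
  have hm : Measurable (phi a) := (continuous_phi a).measurable
  set G : ℝ → ℝ → ℝ≥0∞ := fun P Q => b (P + Q) * ENNReal.ofReal (P * Q)⁻¹ with hG
  have hGm : Measurable fun q : ℝ × ℝ => G q.1 q.2 := by
    simp only [hG]; fun_prop
  set p : ℝ → ℝ → ℝ := fun x r => √(a ^ 2 + x ^ 2 + r ^ 2) with hp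
  have hn1 : ∀ (x : ℝ) (z : EuclideanSpace ℝ (Fin 4)),
      phi a ‖T (WithLp.toLp 2 (x, z))‖ = p x ‖z‖ := by
    intro x z
    rw [LinearIsometryEquiv.norm_map, WithLp.prod_norm_eq_of_L2, phi, Real.sq_sqrt (by positivity)]
    simp [hp, add_assoc]
  have hn2 : ∀ (x : ℝ) (z : EuclideanSpace ℝ (Fin 4)),
      phi a ‖ξ - T (WithLp.toLp 2 (x, z))‖ = p (c - x) ‖z‖ := by
    intro x z
    have : ξ - T (WithLp.toLp 2 (x, z)) = T (WithLp.toLp 2 (c - x, -z)) := by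
      rw [← hT, ← map_sub, ← WithLp.toLp_sub]
      simp
    rw [this, hn1, norm_neg]
  calc ∫⁻ y : R5, G (phi a ‖y‖) (phi a ‖ξ - y‖)
      = ∫⁻ v : WithLp 2 (ℝ × EuclideanSpace ℝ (Fin 4)), G (phi a ‖T v‖) (phi a ‖ξ - T v‖) := by
        refine (T.measurePreserving.lintegral_comp
          (f := fun y => G (phi a ‖y‖) (phi a ‖ξ - y‖)) ?_).symm
        exact hGm.comp (by fun_prop : Measurable fun y : R5 => (phi a ‖y‖, phi a ‖ξ - y‖))
    _ = ∫⁻ v : ℝ × EuclideanSpace ℝ (Fin 4), G (p v.1 ‖v.2‖) (p (c - v.1) ‖v.2‖) := by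
        rw [← (WithLp.volume_preserving_toLp ℝ (EuclideanSpace ℝ (Fin 4))).lintegral_comp]
        · simp only [hn1, hn2]
        · have hT' : Continuous T := T.continuous
          exact hGm.comp (by fun_prop : Measurable fun v => (phi a ‖T v‖, phi a ‖ξ - T v‖))
    _ = ∫⁻ x : ℝ, ∫⁻ z : EuclideanSpace ℝ (Fin 4), G (p x ‖z‖) (p (c - x) ‖z‖) := by
        rw [Measure.volume_eq_prod, lintegral_prod]
        refine Measurable.aemeasurable ?_
        exact hGm.comp (by fun_prop : Measurable fun v : ℝ × EuclideanSpace ℝ (Fin 4) =>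
          (p v.1 ‖v.2‖, p (c - v.1) ‖v.2‖))
    _ = ∫⁻ x : ℝ, ENNReal.ofReal (2 * Real.pi ^ 2) *
          ∫⁻ r in Set.Ioi (0 : ℝ), ENNReal.ofReal (r ^ 3) * G (p x r) (p (c - x) r) := by
        refine lintegral_congr fun x => ?_
        refine lintegral_comp_norm_euclideanSpace_four (f := fun r => G (p x r) (p (c - x) r)) ?_
        exact hGm.comp (by fun_prop : Measurable fun r : ℝ => (p x r, p (c - x) r))
    _ ≤ ∫⁻ x : ℝ, ENNReal.ofReal (2 * Real.pi ^ 2) *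
          ∫⁻ τ in S, b τ * ENNReal.ofReal (ellipsoidRadiusSq a τ c x / τ) := by
        refine lintegral_mono fun x => mul_le_mul_right ?_ _
        exact lintegral_radius_le_lintegral_energy ha x c b
    _ = ∫⁻ τ in S, b τ * (ENNReal.ofReal (2 * Real.pi ^ 2) *
          ∫⁻ x : ℝ, ENNReal.ofReal (ellipsoidRadiusSq a τ c x / τ)) := by
        have hm2 : Measurable fun q : ℝ × ℝ =>
            b q.2 * ENNReal.ofReal (ellipsoidRadiusSq a q.2 c q.1 / q.2) := by
          unfold ellipsoidRadiusSq; fun_prop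
        rw [lintegral_const_mul' _ _ ENNReal.ofReal_ne_top,
          lintegral_lintegral_swap hm2.aemeasurable, ← lintegral_const_mul' _ _
            ENNReal.ofReal_ne_top]
        refine lintegral_congr fun τ => ?_
        rw [lintegral_const_mul, mul_left_comm]
        unfold ellipsoidRadiusSq; fun_prop
    _ ≤ _ := by
        refine setLIntegral_mono' hSm fun τ hτ => mul_le_mul_right ?_ _
        exact lintegral_ellipsoidRadiusSq_le hτ.1 hτ.2

/-- The point `(φ_a(|ξ|), ξ)` of the hyperboloid over `ξ`. -/
noncomputable def hyperboloid (a : ℝ) (ξ : R5) : WithLp 2 (ℝ × R5) :=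
  WithLp.toLp 2 (phi a ‖ξ‖, ξ)

theorem measurable_hyperboloid (a : ℝ) : Measurable (hyperboloid a) := by
  have hm : Measurable (phi a) := (continuous_phi a).measurable
  exact (WithLp.volume_preserving_toLp ℝ R5).measurable.comp
    (by fun_prop : Measurable fun ξ : R5 => (phi a ‖ξ‖, ξ))

/-- The weight of the sharp bilinear estimate. -/
noncomputable def pairWeight (a : ℝ) (q : R5 × R5) : ℝ :=
  phi a ‖q.1‖ * phi a ‖q.2‖ * pairDensity a (phi a ‖q.1‖ + phi a ‖q.2‖) ‖q.1 + q.2‖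

theorem measurable_pairWeight (a : ℝ) : Measurable (pairWeight a) := by
  have hm : Measurable (phi a) := (continuous_phi a).measurable
  have h1 : Measurable fun q : R5 × R5 => phi a ‖q.1‖ * phi a ‖q.2‖ := by fun_prop
  have h2 : Measurable fun q : R5 × R5 => (phi a ‖q.1‖ + phi a ‖q.2‖, ‖q.1 + q.2‖) := by fun_prop
  have h3 := (measurable_pairDensity a).comp h2
  exact h1.mul h3

/-- The excess `(φ(y) + φ(z))² - |y + z|² - 4a²` of the squared invariant mass. -/
theorem invariantMass_sub (a : ℝ) (y z : R5) :
    (phi a ‖y‖ + phi a ‖z‖) ^ 2 - ‖y + z‖ ^ 2 - 4 * a ^ 2 =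
      2 * (phi a ‖y‖ * phi a ‖z‖ - inner ℝ y z - a ^ 2) := by
  have h := norm_add_sq_real y z
  have h1 := phi_sq a ‖y‖
  have h2 := phi_sq a ‖z‖
  nlinarith

/-- The difference of the squares is `a²|y-z|² + (|y|²|z|² - (y·z)²)`, so degeneracy occurs only on
the diagonal. -/
theorem phi_mul_phi_gt {a : ℝ} (ha : 0 < a) {y z : R5} (h : y ≠ z) :
    inner ℝ y z + a ^ 2 < phi a ‖y‖ * phi a ‖z‖ := by
  refine lt_of_pow_lt_pow_left₀ 2 (mul_pos (phi_pos ha _) (phi_pos ha _)).le ?_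
  rw [mul_pow, phi_sq, phi_sq]
  have h1 := norm_sub_sq_real y z
  have h2 : 0 < ‖y - z‖ ^ 2 := by
    have := norm_pos_iff.2 (sub_ne_zero.2 h); positivity
  have h3 : (inner ℝ y z) ^ 2 ≤ ‖y‖ ^ 2 * ‖z‖ ^ 2 := by
    rw [← mul_pow]
    exact sq_le_sq' (by linarith [neg_le_of_abs_le (abs_real_inner_le_norm y z)])
      (real_inner_le_norm y z)
  have h4 : 0 < a ^ 2 * ‖y - z‖ ^ 2 := by positivity
  nlinarith

theorem phi_mul_phi_ge {a : ℝ} (ha : 0 < a) (y z : R5) :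
    inner ℝ y z + a ^ 2 ≤ phi a ‖y‖ * phi a ‖z‖ := by
  rcases eq_or_ne y z with rfl | h
  · rw [← pow_two, phi_sq, real_inner_self_eq_norm_sq]; linarith
  · exact (phi_mul_phi_gt ha h).le

theorem pairWeight_pos {a : ℝ} (ha : 0 < a) {q : R5 × R5} (h : q.1 ≠ q.2) :
    0 < pairWeight a q := by
  have h1 := phi_pos ha ‖q.1‖
  have h2 := phi_pos ha ‖q.2‖
  have h3 := phi_mul_phi_gt ha h
  have h4 := invariantMass_sub a q.1 q.2
  have h5 : 0 < (phi a ‖q.1‖ + phi a ‖q.2‖) ^ 2 - ‖q.1 + q.2‖ ^ 2 - 4 * a ^ 2 := by linarith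
  have h6 : 0 < (phi a ‖q.1‖ + phi a ‖q.2‖) ^ 2 - ‖q.1 + q.2‖ ^ 2 := by nlinarith
  unfold pairWeight pairDensity
  have := Real.pi_pos
  positivity

theorem ae_fst_ne_snd : ∀ᵐ q : R5 × R5, q.1 ≠ q.2 := by
  have hs : MeasurableSet {q : R5 × R5 | q.1 ≠ q.2} :=
    (isClosed_eq continuous_fst continuous_snd).measurableSet.compl
  rw [Measure.volume_eq_prod, Measure.ae_prod_iff_ae_ae hs]
  exact ae_of_all _ fun y => by simp [ae_iff]

/-- After `z = ξ - y`, each fibre over `ξ` has energy density at most `pairDensity`, which the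
inverse weight cancels. Hence the image of the reciprocally weighted measure has density at most
`1`. -/
theorem lintegral_comp_hyperboloid_add_le {a : ℝ} (ha : 0 < a) {B : WithLp 2 (ℝ × R5) → ℝ≥0∞}
    (hB : Measurable B) :
    ∫⁻ q : R5 × R5, B (hyperboloid a q.1 + hyperboloid a q.2) *
      (ENNReal.ofReal (pairWeight a q))⁻¹ ≤ ∫⁻ w, B w := by
  have hm : Measurable (phi a) := (continuous_phi a).measurable
  have htoLp : Measurable (WithLp.toLp 2 : ℝ × R5 → WithLp 2 (ℝ × R5)) :=
    (WithLp.volume_preserving_toLp ℝ R5).measurable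
  have hmeas : Measurable fun q : R5 × R5 => B (hyperboloid a q.1 + hyperboloid a q.2) *
      (ENNReal.ofReal (pairWeight a q))⁻¹ := by
    have h1 := (measurable_hyperboloid a)
    have h2 := measurable_pairWeight a
    fun_prop
  calc ∫⁻ q : R5 × R5, B (hyperboloid a q.1 + hyperboloid a q.2) *
        (ENNReal.ofReal (pairWeight a q))⁻¹
      = ∫⁻ y : R5, ∫⁻ z : R5, B (hyperboloid a y + hyperboloid a z) *
        (ENNReal.ofReal (pairWeight a (y, z)))⁻¹ := by
        rw [Measure.volume_eq_prod, lintegral_prod _ hmeas.aemeasurable]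
    _ = ∫⁻ y : R5, ∫⁻ ξ : R5, B (hyperboloid a y + hyperboloid a (ξ - y)) *
        (ENNReal.ofReal (pairWeight a (y, ξ - y)))⁻¹ := by
        refine lintegral_congr fun y => ?_
        rw [lintegral_sub_right_eq_self (fun z => B (hyperboloid a y + hyperboloid a z) *
          (ENNReal.ofReal (pairWeight a (y, z)))⁻¹) y]
    _ = ∫⁻ ξ : R5, ∫⁻ y : R5, B (hyperboloid a y + hyperboloid a (ξ - y)) *
        (ENNReal.ofReal (pairWeight a (y, ξ - y)))⁻¹ := by
        rw [lintegral_lintegral_swap]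
        exact (hmeas.comp (by fun_prop :
          Measurable fun q : R5 × R5 => (q.1, q.2 - q.1))).aemeasurable
    _ ≤ ∫⁻ ξ : R5, ∫⁻ τ : ℝ, B (WithLp.toLp 2 (τ, ξ)) := by
        refine lintegral_mono fun ξ => ?_
        set b : ℝ → ℝ≥0∞ := fun τ =>
          B (WithLp.toLp 2 (τ, ξ)) * (ENNReal.ofReal (pairDensity a τ ‖ξ‖))⁻¹ with hb
        have hbm : Measurable b := by
          refine (hB.comp (htoLp.comp (by fun_prop))).mul ?_
          exact ((measurable_pairDensity a).comp
            (by fun_prop : Measurable fun τ : ℝ => (τ, ‖ξ‖))).ennreal_ofReal.inv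
        calc _ = ∫⁻ y : R5, b (phi a ‖y‖ + phi a ‖ξ - y‖) *
              ENNReal.ofReal (phi a ‖y‖ * phi a ‖ξ - y‖)⁻¹ := by
              refine lintegral_congr fun y => ?_
              have h1 : hyperboloid a y + hyperboloid a (ξ - y)
                  = WithLp.toLp 2 (phi a ‖y‖ + phi a ‖ξ - y‖, ξ) := by
                simp only [hyperboloid, ← WithLp.toLp_add, Prod.mk_add_mk, add_sub_cancel]
              have h2 : 0 < phi a ‖y‖ * phi a ‖ξ - y‖ := mul_pos (phi_pos ha _) (phi_pos ha _)
              simp only [hb, h1, pairWeight, add_sub_cancel]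
              rw [ENNReal.ofReal_mul h2.le, ENNReal.mul_inv (Or.inl (by simpa using h2))
                (Or.inl ENNReal.ofReal_ne_top), ENNReal.ofReal_inv_of_pos h2]
              ring
          _ ≤ _ := lintegral_comp_energy_le ha ξ hbm
          _ ≤ ∫⁻ τ in {τ : ℝ | 0 < τ ∧ 4 * a ^ 2 < τ ^ 2 - ‖ξ‖ ^ 2}, B (WithLp.toLp 2 (τ, ξ)) := by
              refine lintegral_mono fun τ => ?_
              simp only [hb]
              rw [mul_assoc]
              exact mul_le_of_le_one_right' (ENNReal.inv_mul_le_one _)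
          _ ≤ _ := setLIntegral_le_lintegral _ _
    _ = ∫⁻ w, B w := by
        rw [← (WithLp.volume_preserving_toLp ℝ R5).lintegral_comp hB, Measure.volume_eq_prod,
          lintegral_prod_symm]
        exact (hB.comp htoLp).aemeasurable

/-- The `L⁴` norm is the `L²` norm of the square, and characters turn the square into the extension
of `F ⊗ F` along the sum map. -/
theorem lintegral_extensionOp_hyperboloid_le {a : ℝ} (ha : 0 < a) {F : R5 → ℂ}
    (hF : Integrable F) :
    ∫⁻ w, ‖extensionOp volume (hyperboloid a) F w‖ₑ ^ 4 ≤
      ∫⁻ q : R5 × R5, (‖F q.1‖ₑ ^ 2 * ‖F q.2‖ₑ ^ 2) * ENNReal.ofReal (pairWeight a q) := by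
  have hsq : ∀ w, extensionOp volume (hyperboloid a) F w ^ 2 =
      extensionOp (volume : Measure (R5 × R5))
        (fun q => hyperboloid a q.1 + hyperboloid a q.2) (fun q => F q.1 * F q.2) w := by
    intro w
    unfold extensionOp
    rw [pow_two, Measure.volume_eq_prod, ← integral_prod_mul]
    congr 1
    ext q
    simp only [inner_add_right, AddChar.map_add_eq_mul, Circle.smul_def, Circle.coe_mul,
      smul_eq_mul]
    ring
  have hm := measurable_hyperboloid a
  have := lintegral_enorm_sq_extensionOp_le (ν := (volume : Measure (R5 × R5)))
    (Φ := fun q => hyperboloid a q.1 + hyperboloid a q.2) (by fun_prop)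
    (G := fun q => F q.1 * F q.2) (hF.mul_prod hF)
    (κ := fun q => ENNReal.ofReal (pairWeight a q)) (measurable_pairWeight a).ennreal_ofReal
    (ae_fst_ne_snd.mono fun q hq => by simpa using pairWeight_pos ha hq)
    (fun q => ENNReal.ofReal_ne_top) (fun B hB => lintegral_comp_hyperboloid_add_le ha hB)
  convert! this using 3 with w q
  · rw [← hsq, enorm_pow, ← pow_mul]
  · rw [enorm_mul, mul_pow]

end Pair

/-! ### The Klein–Gordon propagator and its refined space-time bound -/

section Propagator

theorem memLp_symbolMul_of_bounded {m : ℝ → ℂ} (hm : Continuous m) {C : ℝ} (hC : ∀ r, ‖m r‖ ≤ C)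
    (f : L2) : MemLp (symbolMul m f) 2 volume := by
  have h1 : AEStronglyMeasurable (fun ξ : R5 => m (2 * Real.pi * ‖ξ‖)) volume :=
    (by fun_prop : Continuous fun ξ : R5 => m (2 * Real.pi * ‖ξ‖)).aestronglyMeasurable
  refine (Lp.memLp (𝓕 f : L2)).of_le_mul (c := C) (h1.mul (Lp.aestronglyMeasurable _))
    (ae_of_all _ fun ξ => ?_)
  rw [symbolMul, norm_mul]
  gcongr
  exact hC _

theorem continuous_waveSymbol (s t : ℝ) :
    Continuous fun r : ℝ => Complex.exp (Complex.I * (t * phi s r : ℝ)) := by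
  have := continuous_phi s
  fun_prop

theorem norm_waveSymbol (s t r : ℝ) : ‖Complex.exp (Complex.I * (t * phi s r : ℝ))‖ = 1 := by
  rw [mul_comm, Complex.norm_exp_ofReal_mul_I]

theorem inDomain_waveSymbol (s t : ℝ) (f : L2) :
    InDomain (fun r => Complex.exp (Complex.I * (t * phi s r : ℝ))) f :=
  memLp_symbolMul_of_bounded (continuous_waveSymbol s t) (fun r => (norm_waveSymbol s t r).le) f

theorem funcSqrtLaplacian_of_inDomain {m : ℝ → ℂ} {f : L2} (h : InDomain m f) :
    funcSqrtLaplacian m f = 𝓕⁻ (MemLp.toLp (symbolMul m f) h) := dif_pos h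

theorem fourier_funcSqrtLaplacian {m : ℝ → ℂ} {f : L2} (h : InDomain m f) :
    ((𝓕 (funcSqrtLaplacian m f) : L2) : R5 → ℂ) =ᵐ[volume] symbolMul m f := by
  rw [funcSqrtLaplacian_of_inDomain h, FourierTransform.fourier_fourierInv_eq]
  exact MemLp.coeFn_toLp _

theorem fourier_propagator (s t : ℝ) (f : L2) :
    ((𝓕 (propagator s t f) : L2) : R5 → ℂ) =ᵐ[volume]
      fun ξ => Complex.exp (Complex.I * (t * phi s (2 * Real.pi * ‖ξ‖) : ℝ)) * (𝓕 f : L2) ξ :=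
  fourier_funcSqrtLaplacian (inDomain_waveSymbol s t f)

theorem fourier_injective {f g : L2} (h : ((𝓕 f : L2) : R5 → ℂ) =ᵐ[volume] (𝓕 g : L2)) :
    f = g :=
  (Lp.fourierTransformₗᵢ R5 ℂ).injective (Lp.ext h)

theorem fourier_add_ae (f g : L2) :
    ((𝓕 (f + g) : L2) : R5 → ℂ) =ᵐ[volume] fun ξ => (𝓕 f : L2) ξ + (𝓕 g : L2) ξ := by
  rw [FourierTransform.fourier_add]
  exact Lp.coeFn_add _ _

theorem propagator_add (s t : ℝ) (f g : L2) :
    propagator s t (f + g) = propagator s t f + propagator s t g := by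
  apply fourier_injective
  filter_upwards [fourier_propagator s t (f + g), fourier_add_ae f g, fourier_propagator s t f,
    fourier_propagator s t g, fourier_add_ae (propagator s t f) (propagator s t g)]
    with ξ h1 h2 h3 h4 h5
  rw [h1, h2, h5, h3, h4]
  ring

theorem norm_propagator (s t : ℝ) (f : L2) : ‖propagator s t f‖ = ‖f‖ := by
  rw [← Lp.norm_fourier_eq, ← Lp.norm_fourier_eq f, Lp.norm_def, Lp.norm_def]
  congr 1
  refine eLpNorm_congr_norm_ae ?_
  filter_upwards [fourier_propagator s t f] with ξ h
  rw [h, norm_mul, norm_waveSymbol, one_mul]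

theorem norm_sq_eq_lintegral (f : L2) : ‖f‖ₑ ^ 2 = ∫⁻ ξ, ‖(𝓕 f : L2) ξ‖ₑ ^ 2 := by
  have key : ∀ f : R5 → ℂ, eLpNorm f 2 volume ^ 2 = ∫⁻ w, ‖f w‖ₑ ^ 2 := fun f => by
    simpa using eLpNorm_nnreal_pow_eq_lintegral (f := f) (μ := volume) (p := 2) (by norm_num)
  rw [← key, ← Lp.enorm_def, ← ofReal_norm, ← ofReal_norm, Lp.norm_fourier_eq]

theorem fourier_sub_ae (f g : L2) :
    ((𝓕 (f - g) : L2) : R5 → ℂ) =ᵐ[volume] fun ξ => (𝓕 f : L2) ξ - (𝓕 g : L2) ξ := by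
  have : (𝓕 (f - g) : L2) = 𝓕 f - 𝓕 g := (Lp.fourierTransformₗᵢ R5 ℂ).map_sub f g
  rw [this]
  exact Lp.coeFn_sub _ _

theorem lintegral_fourier_sq_lt_top (f : L2) : ∫⁻ ξ, ‖(𝓕 f : L2) ξ‖ₑ ^ 2 < ∞ := by
  rw [← norm_sq_eq_lintegral]
  exact ENNReal.pow_lt_top enorm_lt_top

/-- Dominated convergence on the Fourier side. -/
theorem tendsto_of_fourier_dominated {u : ℕ → L2} {v F : L2}
    (hle : ∀ n, ∀ᵐ ξ, ‖(𝓕 (u n) : L2) ξ‖ ≤ ‖(𝓕 F : L2) ξ‖)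
    (hle' : ∀ᵐ ξ, ‖(𝓕 v : L2) ξ‖ ≤ ‖(𝓕 F : L2) ξ‖)
    (hlim : ∀ᵐ ξ, Tendsto (fun n => (𝓕 (u n) : L2) ξ) atTop (𝓝 ((𝓕 v : L2) ξ))) :
    Tendsto u atTop (𝓝 v) := by
  rw [tendsto_iff_edist_tendsto_0]
  have h2 : Tendsto (fun n => edist (u n) v ^ 2) atTop (𝓝 0) := by
    have e : ∀ n, edist (u n) v ^ 2 = ∫⁻ ξ, ‖(𝓕 (u n) : L2) ξ - (𝓕 v : L2) ξ‖ₑ ^ 2 := by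
      intro n
      rw [edist_eq_enorm_sub, norm_sq_eq_lintegral]
      refine lintegral_congr_ae ?_
      filter_upwards [fourier_sub_ae (u n) v] with ξ h
      rw [h]
    simp_rw [e]
    have hz : ∫⁻ _ : R5, (0 : ℝ≥0∞) = 0 := by simp
    rw [← hz]
    refine tendsto_lintegral_of_dominated_convergence'
      (fun ξ => 4 * ‖(𝓕 F : L2) ξ‖ₑ ^ 2) (fun n => ?_) (fun n => ?_) ?_ ?_
    · exact ((Lp.aestronglyMeasurable _).sub (Lp.aestronglyMeasurable _)).enorm.pow_const _
    · filter_upwards [hle n, hle'] with ξ h h'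
      have : ‖(𝓕 (u n) : L2) ξ - (𝓕 v : L2) ξ‖ₑ ≤ 2 * ‖(𝓕 F : L2) ξ‖ₑ := by
        refine (enorm_sub_le).trans ?_
        rw [two_mul]
        exact add_le_add (enorm_le_iff_norm_le.2 h) (enorm_le_iff_norm_le.2 h')
      calc _ ≤ (2 * ‖(𝓕 F : L2) ξ‖ₑ) ^ 2 := by gcongr
        _ = _ := by rw [mul_pow]; norm_num
    · rw [lintegral_const_mul' _ _ (by norm_num)]
      exact (ENNReal.mul_lt_top (by norm_num) (lintegral_fourier_sq_lt_top F)).ne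
    · filter_upwards [hlim] with ξ h
      have h3 : Tendsto (fun n => (𝓕 (u n) : L2) ξ - (𝓕 v : L2) ξ) atTop (𝓝 0) := by
        simpa using h.sub_const ((𝓕 v : L2) ξ)
      have := (ENNReal.continuous_pow 2).tendsto 0 |>.comp ((continuous_enorm.tendsto _).comp h3
        |>.trans (by simp))
      simpa [Function.comp_def] using this
  have h3 := (ENNReal.continuous_rpow_const (y := 1 / 2)).tendsto 0 |>.comp h2
  refine Tendsto.congr (fun n => ?_) (h3.trans (by simp))
  simp only [Function.comp]
  rw [← ENNReal.rpow_natCast, ← ENNReal.rpow_mul]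
  norm_num

theorem continuous_propagator (s : ℝ) (f : L2) : Continuous fun t => propagator s t f := by
  refine continuous_iff_seqContinuous.2 fun x t hx => ?_
  refine tendsto_of_fourier_dominated (F := f) (fun n => ?_) ?_ ?_
  · filter_upwards [fourier_propagator s (x n) f] with ξ h
    rw [Function.comp, h, norm_mul, norm_waveSymbol, one_mul]
  · filter_upwards [fourier_propagator s t f] with ξ h
    rw [h, norm_mul, norm_waveSymbol, one_mul]
  · have : ∀ᵐ ξ, ∀ n, ((𝓕 (propagator s (x n) f) : L2) : R5 → ℂ) ξ = _ :=
      ae_all_iff.2 fun n => fourier_propagator s (x n) f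
    filter_upwards [this, fourier_propagator s t f] with ξ h h'
    simp only [Function.comp, h, h']
    have hc : Continuous fun t : ℝ =>
      Complex.exp (Complex.I * (t * phi s (2 * Real.pi * ‖ξ‖) : ℝ)) := by fun_prop
    exact ((hc.tendsto t).comp hx).mul_const _

/-- An `L²`-convergent sequence has an almost everywhere convergent subsequence, to which Fatou
applies. This also yields measurability in time of the spatial `L⁴` norm. -/
theorem lowerSemicontinuous_eLpNorm {α : Type*} [MeasurableSpace α] {μ : Measure α} (p : ℝ≥0∞) :
    LowerSemicontinuous fun h : Lp ℂ 2 μ => eLpNorm h p μ := by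
  refine lowerSemicontinuous_iff_isClosed_preimage.2 fun C => ?_
  refine IsSeqClosed.isClosed fun u h hu hlim => ?_
  have hm := tendstoInMeasure_of_tendsto_Lp hlim
  obtain ⟨ns, -, hns⟩ := hm.exists_seq_tendsto_ae
  exact Lp.eLpNorm_le_of_ae_tendsto (u := atTop) (f := fun n => (u (ns n) : α → ℂ))
    (Eventually.of_forall fun n => hu (ns n)) (fun n => Lp.aestronglyMeasurable _) hns

theorem measurable_eLpNorm_propagator (s : ℝ) (f : L2) :
    Measurable fun t : ℝ => eLpNorm (propagator s t f) 4 volume :=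
  ((lowerSemicontinuous_eLpNorm 4).comp (continuous_propagator s f)).measurable

/-- The fourth power of the space-time norm. -/
noncomputable def spaceTimeFour (s : ℝ) (f : L2) : ℝ≥0∞ :=
  ∫⁻ t : ℝ, eLpNorm (propagator s t f) 4 volume ^ 4

theorem spaceTimeL4_eq (s : ℝ) (f : L2) : spaceTimeL4 s f = spaceTimeFour s f ^ (1 / 4 : ℝ) := rfl

theorem spaceTimeL4_add_le (s : ℝ) (f g : L2) :
    spaceTimeL4 s (f + g) ≤ spaceTimeL4 s f + spaceTimeL4 s g := by
  have e : ∀ x : ℝ≥0∞, x ^ 4 = x ^ (4 : ℝ) := fun x => by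
    rw [← ENNReal.rpow_natCast]; norm_num
  unfold spaceTimeL4
  simp_rw [e]
  refine le_trans ?_ (ENNReal.lintegral_Lp_add_le
    (measurable_eLpNorm_propagator s f).aemeasurable
    (measurable_eLpNorm_propagator s g).aemeasurable (by norm_num))
  gcongr with t
  rw [propagator_add, eLpNorm_congr_ae (Lp.coeFn_add _ _)]
  exact eLpNorm_add_le (Lp.aestronglyMeasurable _) (Lp.aestronglyMeasurable _) (by norm_num)

theorem spaceTimeFour_le_liminf (s : ℝ) {u : ℕ → L2} {f : L2} (h : Tendsto u atTop (𝓝 f)) :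
    spaceTimeFour s f ≤ liminf (fun n => spaceTimeFour s (u n)) atTop := by
  have hc : ∀ t, Continuous (propagator s t) := by
    intro t
    refine Isometry.continuous (Isometry.of_dist_eq fun f g => ?_)
    have : propagator s t f = propagator s t (f - g) + propagator s t g := by
      rw [← propagator_add, sub_add_cancel]
    rw [dist_eq_norm, this, add_sub_cancel_right, norm_propagator, dist_eq_norm]
  unfold spaceTimeFour
  refine le_trans (lintegral_mono fun t => ?_) (lintegral_liminf_le fun n =>
    (measurable_eLpNorm_propagator s (u n)).pow_const 4)
  have hl : LowerSemicontinuous fun h : L2 => eLpNorm h 4 volume ^ 4 := by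
    refine Continuous.comp_lowerSemicontinuous (ENNReal.continuous_pow 4)
      (lowerSemicontinuous_eLpNorm 4) (fun a b hab => pow_le_pow_left' hab 4)
  refine (hl.le_liminf (propagator s t f)).trans ?_
  exact liminf_le_liminf_of_le (u := fun h : L2 => eLpNorm h 4 volume ^ 4)
    (((hc t).tendsto f).comp h)

theorem phi_two_pi (s r : ℝ) :
    phi s (2 * Real.pi * r) = 2 * Real.pi * phi (s / (2 * Real.pi)) r := by
  have hp : 0 < 2 * Real.pi := by positivity
  rw [phi, phi, ← Real.sqrt_sq hp.le, ← Real.sqrt_mul (by positivity), Real.sqrt_sq hp.le]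
  congr 1
  field_simp

/-- Mathlib's character carries a factor `2π`, and `φ_s(2πr) = 2πφ_a(r)` with `a = s/2π`; hence the
rescaled mass in the hyperboloid. -/
theorem propagator_ae_eq_extensionOp (s t : ℝ) {f : L2} (hf : Integrable (𝓕 f : L2)) :
    (propagator s t f : R5 → ℂ) =ᵐ[volume] fun x =>
      extensionOp volume (hyperboloid (s / (2 * Real.pi))) (𝓕 f : L2) (WithLp.toLp 2 (t, x)) := by
  have hd := inDomain_waveSymbol s t f
  have hint : Integrable (symbolMul (fun r => Complex.exp (Complex.I * (t * phi s r : ℝ))) f) := by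
    refine hf.mono hd.1 (ae_of_all _ fun ξ => ?_)
    rw [symbolMul, norm_mul, norm_waveSymbol, one_mul]
  unfold propagator
  rw [funcSqrtLaplacian_of_inDomain hd]
  refine (fourierInv_toLp_ae_eq hint hd).trans (Eventually.of_forall fun x => ?_)
  simp only [Real.fourierInv_eq, extensionOp]
  refine integral_congr_ae (ae_of_all _ fun ξ => ?_)
  simp only [symbolMul, Circle.smul_def, smul_eq_mul, Real.fourierChar_apply, hyperboloid,
    WithLp.prod_inner_apply]
  rw [← mul_assoc, ← Complex.exp_add, phi_two_pi, real_inner_comm x ξ]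
  congr 2
  simp only [RCLike.inner_apply, conj_trivial]
  push_cast
  ring

theorem spaceTimeFour_le_of_integrable {s : ℝ} (hs : 0 < s) {f : L2}
    (hf : Integrable (𝓕 f : L2)) :
    spaceTimeFour s f ≤ ∫⁻ q : R5 × R5, (‖(𝓕 f : L2) q.1‖ₑ ^ 2 * ‖(𝓕 f : L2) q.2‖ₑ ^ 2) *
      ENNReal.ofReal (pairWeight (s / (2 * Real.pi)) q) := by
  have ha : 0 < s / (2 * Real.pi) := by positivity
  refine le_trans (le_of_eq ?_) (lintegral_extensionOp_hyperboloid_le ha hf)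
  set u := extensionOp volume (hyperboloid (s / (2 * Real.pi))) (𝓕 f : L2) with hu
  have huc : Continuous u := continuous_extensionOp (measurable_hyperboloid _) hf
  have hum : Measurable fun w => ‖u w‖ₑ ^ 4 := (huc.enorm.measurable).pow_const 4
  have htoLp := (WithLp.volume_preserving_toLp ℝ R5)
  have hprod := lintegral_prod (μ := (volume : Measure ℝ)) (ν := (volume : Measure R5))
    (fun q : ℝ × R5 => ‖u (WithLp.toLp 2 q)‖ₑ ^ 4) (hum.comp htoLp.measurable).aemeasurable
  rw [← htoLp.lintegral_comp hum, Measure.volume_eq_prod, hprod, spaceTimeFour]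
  refine lintegral_congr fun t => ?_
  rw [eLpNorm_congr_ae (propagator_ae_eq_extensionOp s t hf)]
  simpa using eLpNorm_nnreal_pow_eq_lintegral (f := fun x => u (WithLp.toLp 2 (t, x)))
    (μ := volume) (p := 4) (by norm_num)

theorem memLp_indicator_fourier {S : Set R5} (hS : MeasurableSet S) (f : L2) :
    MemLp (S.indicator (𝓕 f : L2)) 2 volume := (Lp.memLp (𝓕 f : L2)).indicator hS

/-- The sharp Fourier restriction of `f` to the frequency set `S`. -/
noncomputable def freqRestrict {S : Set R5} (hS : MeasurableSet S) (f : L2) : L2 :=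
  𝓕⁻ (MemLp.toLp _ (memLp_indicator_fourier hS f))

theorem fourier_freqRestrict {S : Set R5} (hS : MeasurableSet S) (f : L2) :
    ((𝓕 (freqRestrict hS f) : L2) : R5 → ℂ) =ᵐ[volume] S.indicator (𝓕 f : L2) := by
  rw [freqRestrict, FourierTransform.fourier_fourierInv_eq]
  exact MemLp.coeFn_toLp _

theorem freqRestrict_add_compl {S : Set R5} (hS : MeasurableSet S) (f : L2) :
    freqRestrict hS f + freqRestrict hS.compl f = f := by
  apply fourier_injective
  filter_upwards [fourier_add_ae (freqRestrict hS f) (freqRestrict hS.compl f),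
    fourier_freqRestrict hS f, fourier_freqRestrict hS.compl f] with ξ h1 h2 h3
  rw [h1, h2, h3, Set.indicator_self_add_compl_apply]

theorem lintegral_prod_congr_fourier {f : L2} {F : R5 → ℂ}
    (h : ((𝓕 f : L2) : R5 → ℂ) =ᵐ[volume] F) (w : R5 × R5 → ℝ≥0∞) :
    ∫⁻ q : R5 × R5, (‖(𝓕 f : L2) q.1‖ₑ ^ 2 * ‖(𝓕 f : L2) q.2‖ₑ ^ 2) * w q =
      ∫⁻ q : R5 × R5, (‖F q.1‖ₑ ^ 2 * ‖F q.2‖ₑ ^ 2) * w q := by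
  refine lintegral_congr_ae ?_
  filter_upwards [Measure.quasiMeasurePreserving_fst.ae h, Measure.quasiMeasurePreserving_snd.ae h]
    with q h1 h2
  rw [h1, h2]

/-- The refined form of the sharp space-time estimate. -/
theorem spaceTimeFour_le {s : ℝ} (hs : 0 < s) (f : L2) :
    spaceTimeFour s f ≤ ∫⁻ q : R5 × R5, (‖(𝓕 f : L2) q.1‖ₑ ^ 2 * ‖(𝓕 f : L2) q.2‖ₑ ^ 2) *
      ENNReal.ofReal (pairWeight (s / (2 * Real.pi)) q) := by
  -- Truncation to frequency balls makes the Fourier transform integrable and only decreases the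
  -- right-hand side; lower semicontinuity passes to the limit on the left.
  have hS : ∀ n : ℕ, MeasurableSet (Metric.closedBall (0 : R5) (n : ℝ)) := fun n =>
    Metric.isClosed_closedBall.measurableSet
  set u : ℕ → L2 := fun n => freqRestrict (hS n) f with hu
  have hlim : Tendsto u atTop (𝓝 f) := by
    have hall : ∀ᵐ ξ, ∀ n, ((𝓕 (u n) : L2) : R5 → ℂ) ξ = _ :=
      ae_all_iff.2 fun n => fourier_freqRestrict (hS n) f
    refine tendsto_of_fourier_dominated (F := f) (fun n => ?_) (by simp) ?_
    · filter_upwards [hall] with ξ h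
      rw [h]
      exact norm_indicator_le_norm_self _ _
    · filter_upwards [hall] with ξ h
      simp_rw [h]
      refine tendsto_const_nhds.congr' ?_
      obtain ⟨N, hN⟩ := exists_nat_ge ‖ξ‖
      filter_upwards [eventually_ge_atTop N] with n hn
      rw [Set.indicator_of_mem]
      simpa using hN.trans (by exact_mod_cast hn)
  refine (spaceTimeFour_le_liminf s hlim).trans ?_
  refine liminf_le_of_le (by isBoundedDefault) fun b hb => ?_
  obtain ⟨n, hn⟩ := hb.exists
  refine hn.trans ?_
  have hint : Integrable (𝓕 (u n) : L2) := by
    rw [integrable_congr (fourier_freqRestrict (hS n) f), integrable_indicator_iff (hS n)]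
    have : IsFiniteMeasure (volume.restrict (Metric.closedBall (0 : R5) (n : ℝ))) :=
      ⟨by simpa using measure_closedBall_lt_top⟩
    exact (((Lp.memLp (𝓕 f : L2)).restrict _).integrable (by norm_num))
  refine (spaceTimeFour_le_of_integrable hs hint).trans ?_
  rw [lintegral_prod_congr_fourier (fourier_freqRestrict (hS n) f)]
  gcongr
  · exact enorm_indicator_le_enorm_self _ _
  · exact enorm_indicator_le_enorm_self _ _

end Propagator

/-! ### Comparison of the bilinear weight with the energy kernel -/

section Kernel

/-- `φ_s(|y|) φ_s(|z|) - y·z - s²` at the frequencies `y = 2π q₁`, `z = 2π q₂`. -/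
noncomputable def massExcess (s : ℝ) (q : R5 × R5) : ℝ :=
  phi s (2 * Real.pi * ‖q.1‖) * phi s (2 * Real.pi * ‖q.2‖) -
    4 * Real.pi ^ 2 * inner ℝ q.1 q.2 - s ^ 2

/-- The kernel dominating `pairWeight`. -/
noncomputable def energyKernel (s : ℝ) (q : R5 × R5) : ℝ :=
  phi s (2 * Real.pi * ‖q.1‖) * phi s (2 * Real.pi * ‖q.2‖) * massExcess s q

theorem massExcess_eq (s : ℝ) (q : R5 × R5) :
    massExcess s q = 2 * Real.pi ^ 2 *
      ((phi (s / (2 * Real.pi)) ‖q.1‖ + phi (s / (2 * Real.pi)) ‖q.2‖) ^ 2 - ‖q.1 + q.2‖ ^ 2 -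
        4 * (s / (2 * Real.pi)) ^ 2) := by
  rw [invariantMass_sub, massExcess, phi_two_pi, phi_two_pi]
  have := Real.pi_pos
  field_simp
  ring

theorem massExcess_nonneg {s : ℝ} (hs : 0 < s) (q : R5 × R5) : 0 ≤ massExcess s q := by
  have ha : 0 < s / (2 * Real.pi) := by positivity
  rw [massExcess_eq, invariantMass_sub]
  have := phi_mul_phi_ge ha q.1 q.2
  exact mul_nonneg (by positivity) (by linarith)

theorem energyKernel_nonneg {s : ℝ} (hs : 0 < s) (q : R5 × R5) : 0 ≤ energyKernel s q :=
  mul_nonneg (mul_pos (phi_pos hs _) (phi_pos hs _)).le (massExcess_nonneg hs q)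

/-- The sharp constant is `1/(4π²) · π²/3 · 1/(2π²)`: from rescaling the two energies, from
`pairDensity`, and from rescaling the mass excess. -/
theorem pairWeight_eq {s : ℝ} (q : R5 × R5) {A M : ℝ}
    (hA : A = (phi (s / (2 * Real.pi)) ‖q.1‖ + phi (s / (2 * Real.pi)) ‖q.2‖) ^ 2 -
      ‖q.1 + q.2‖ ^ 2 - 4 * (s / (2 * Real.pi)) ^ 2)
    (hM : M = A + 4 * (s / (2 * Real.pi)) ^ 2) :
    pairWeight (s / (2 * Real.pi)) q =
      1 / (24 * Real.pi ^ 2) * energyKernel s q * (√A / √M) := by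
  have hM' : M = (phi (s / (2 * Real.pi)) ‖q.1‖ + phi (s / (2 * Real.pi)) ‖q.2‖) ^ 2 -
      ‖q.1 + q.2‖ ^ 2 := by rw [hM, hA]; ring
  rw [pairWeight, pairDensity, ← hA, ← hM', energyKernel, massExcess_eq, ← hA, phi_two_pi,
    phi_two_pi]
  have := Real.pi_pos
  field_simp
  ring

theorem pairWeight_le_mul {s : ℝ} (hs : 0 < s) {q : R5 × R5} {B : ℝ}
    (hB : (phi (s / (2 * Real.pi)) ‖q.1‖ + phi (s / (2 * Real.pi)) ‖q.2‖) ^ 2 -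
      ‖q.1 + q.2‖ ^ 2 - 4 * (s / (2 * Real.pi)) ^ 2 ≤ B) :
    pairWeight (s / (2 * Real.pi)) q ≤
      1 / (24 * Real.pi ^ 2) * energyKernel s q *
        √(B / (B + 4 * (s / (2 * Real.pi)) ^ 2)) := by
  have ha : 0 < s / (2 * Real.pi) := by positivity
  rw [pairWeight_eq q rfl rfl]
  set A := (phi (s / (2 * Real.pi)) ‖q.1‖ + phi (s / (2 * Real.pi)) ‖q.2‖) ^ 2 -
      ‖q.1 + q.2‖ ^ 2 - 4 * (s / (2 * Real.pi)) ^ 2 with hA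
  have hA0 : 0 ≤ A := by
    rw [hA, invariantMass_sub]
    have := phi_mul_phi_ge ha q.1 q.2
    linarith
  have h0 := energyKernel_nonneg hs q
  refine mul_le_mul_of_nonneg_left ?_ (by positivity)
  rw [← Real.sqrt_div hA0]
  refine Real.sqrt_le_sqrt ?_
  have : 0 < (s / (2 * Real.pi)) ^ 2 := by positivity
  rw [div_le_div_iff₀ (by linarith) (by linarith)]
  nlinarith

theorem pairWeight_le {s : ℝ} (hs : 0 < s) (q : R5 × R5) :
    pairWeight (s / (2 * Real.pi)) q ≤ 1 / (24 * Real.pi ^ 2) * energyKernel s q := by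
  refine (pairWeight_le_mul hs le_rfl).trans ?_
  have ha : 0 < s / (2 * Real.pi) := by positivity
  have h0 := energyKernel_nonneg hs q
  refine mul_le_of_le_one_right (by positivity) ?_
  refine Real.sqrt_le_iff.2 ⟨zero_le_one, ?_⟩
  rw [one_pow]
  have := phi_mul_phi_ge ha q.1 q.2
  rw [invariantMass_sub]
  have : 0 < (s / (2 * Real.pi)) ^ 2 := by positivity
  rw [div_le_one (by linarith)]
  linarith

/-- On a ball the mass excess is bounded, so `t/(t + 4a²)`, increasing in `t`, stays strictly below
`1`. The positive mass gives this uniform gain. -/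
theorem exists_pairWeight_le_of_norm_le {s : ℝ} (hs : 0 < s) (R : ℝ) :
    ∃ θ : ℝ, 0 < θ ∧ ∀ q : R5 × R5, ‖q.1‖ ≤ R → ‖q.2‖ ≤ R →
      pairWeight (s / (2 * Real.pi)) q + θ * energyKernel s q ≤
        1 / (24 * Real.pi ^ 2) * energyKernel s q := by
  have ha : 0 < s / (2 * Real.pi) := by positivity
  set a := s / (2 * Real.pi) with hadef
  set B := (phi a R + phi a R) ^ 2 with hB
  have hB0 : 0 ≤ B := by positivity
  have hlt : √(B / (B + 4 * a ^ 2)) < 1 := by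
    rw [Real.sqrt_lt' one_pos, div_lt_iff₀ (by positivity)]
    have : 0 < a ^ 2 := by positivity
    linarith
  refine ⟨1 / (24 * Real.pi ^ 2) * (1 - √(B / (B + 4 * a ^ 2))), ?_, fun q h1 h2 => ?_⟩
  · have : 0 < 1 - √(B / (B + 4 * a ^ 2)) := by linarith
    positivity
  · have hmono : ∀ r, 0 ≤ r → r ≤ R → phi a r ≤ phi a R := fun r h0 h => by
      unfold phi; gcongr
    have h3 := hmono _ (norm_nonneg q.1) h1
    have h4 := hmono _ (norm_nonneg q.2) h2
    have h5 := phi_pos ha ‖q.1‖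
    have h6 := phi_pos ha ‖q.2‖
    have h7 : (phi a ‖q.1‖ + phi a ‖q.2‖) ^ 2 ≤ B := by rw [hB]; gcongr
    have := pairWeight_le_mul hs (q := q) (B := B) (by
      rw [← hadef]
      have := sq_nonneg ‖q.1 + q.2‖
      have := sq_nonneg a
      linarith)
    rw [← hadef] at this
    linarith

end Kernel

/-! ### Pair energy and moments -/

section Energy

theorem le_phi (s r : ℝ) : s ≤ phi s r := Real.le_sqrt_of_sq_le (by nlinarith [sq_nonneg r])

/-- The pair interaction energy of the frequency function `F`. -/
noncomputable def pairEnergy (s : ℝ) (F : R5 → ℂ) : ℝ≥0∞ :=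
  ∫⁻ q : R5 × R5, (‖F q.1‖ₑ ^ 2 * ‖F q.2‖ₑ ^ 2) * ENNReal.ofReal (energyKernel s q)

theorem spaceTimeFour_le_pairEnergy {s : ℝ} (hs : 0 < s) {f : L2} {F : R5 → ℂ}
    (hF : ((𝓕 f : L2) : R5 → ℂ) =ᵐ[volume] F) :
    spaceTimeFour s f ≤ ENNReal.ofReal (1 / (24 * Real.pi ^ 2)) * pairEnergy s F := by
  refine (spaceTimeFour_le hs f).trans ?_
  rw [lintegral_prod_congr_fourier hF, pairEnergy, ← lintegral_const_mul' _ _ ENNReal.ofReal_ne_top]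
  refine lintegral_mono fun q => ?_
  rw [mul_left_comm, ← ENNReal.ofReal_mul (by positivity)]
  gcongr
  exact pairWeight_le hs q

/-- The gain is used only for pairs with both frequencies in the ball; every other pair uses the
plain comparison of weights. -/
theorem exists_spaceTimeFour_add_le {s : ℝ} (hs : 0 < s) (R : ℝ) :
    ∃ θ : ℝ, 0 < θ ∧ ∀ f : L2, spaceTimeFour s f + ENNReal.ofReal θ *
      pairEnergy s ((Metric.closedBall (0 : R5) R).indicator (𝓕 f : L2)) ≤
        ENNReal.ofReal (1 / (24 * Real.pi ^ 2)) * pairEnergy s (𝓕 f : L2) := by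
  obtain ⟨θ, hθ, h⟩ := exists_pairWeight_le_of_norm_le hs R
  refine ⟨θ, hθ, fun f => ?_⟩
  refine (add_le_add_left (spaceTimeFour_le hs f) _).trans ?_
  have h0 : AEStronglyMeasurable (𝓕 f : L2) volume := Lp.aestronglyMeasurable _
  generalize ((𝓕 f : L2) : R5 → ℂ) = F at h0 ⊢
  have hFm : AEMeasurable (fun q : R5 × R5 => ‖F q.1‖ₑ ^ 2 * ‖F q.2‖ₑ ^ 2) := by
    exact (h0.comp_fst.enorm.pow_const 2).mul (h0.comp_snd.enorm.pow_const 2)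
  rw [pairEnergy, pairEnergy, ← lintegral_const_mul' _ _ ENNReal.ofReal_ne_top,
    ← lintegral_const_mul' _ _ ENNReal.ofReal_ne_top, ← lintegral_add_left']
  · refine lintegral_mono fun q => ?_
    have hk := energyKernel_nonneg hs q
    by_cases h1 : q.1 ∈ Metric.closedBall (0 : R5) R
    · by_cases h2 : q.2 ∈ Metric.closedBall (0 : R5) R
      · rw [Set.indicator_of_mem h1, Set.indicator_of_mem h2,
          mul_left_comm (ENNReal.ofReal θ), mul_left_comm (ENNReal.ofReal (1 / _)),
          ← ENNReal.ofReal_mul hθ.le, ← ENNReal.ofReal_mul (by positivity), ← mul_add]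
        have hw : 0 ≤ pairWeight (s / (2 * Real.pi)) q := by
          by_cases he : q.1 = q.2
          · rw [pairWeight_eq q rfl rfl]
            positivity
          · exact (pairWeight_pos (by positivity) he).le
        rw [← ENNReal.ofReal_add hw (by positivity)]
        gcongr
        exact h q (by simpa using h1) (by simpa using h2)
      · rw [Set.indicator_of_notMem h2]
        simp only [enorm_zero, ne_eq, OfNat.ofNat_ne_zero, not_false_eq_true, zero_pow, mul_zero,
          zero_mul, add_zero]
        rw [mul_left_comm, ← ENNReal.ofReal_mul (by positivity)]
        gcongr
        exact pairWeight_le hs q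
    · rw [Set.indicator_of_notMem h1]
      simp only [enorm_zero, ne_eq, OfNat.ofNat_ne_zero, not_false_eq_true, zero_pow, mul_zero,
        zero_mul, add_zero]
      rw [mul_left_comm, ← ENNReal.ofReal_mul (by positivity)]
      gcongr
      exact pairWeight_le hs q
  · exact hFm.mul (measurable_pairWeight _).ennreal_ofReal.aemeasurable

/-- `∫ φ_s^k |F|²` in the frequency variable of `𝓕`. -/
noncomputable def moment (s : ℝ) (k : ℕ) (F : R5 → ℂ) : ℝ :=
  ∫ ξ, phi s (2 * Real.pi * ‖ξ‖) ^ k * ‖F ξ‖ ^ 2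

/-- `φ_s F ∈ L²`. -/
def FiniteEnergy (s : ℝ) (F : R5 → ℂ) : Prop :=
  AEStronglyMeasurable F volume ∧ Integrable fun ξ => phi s (2 * Real.pi * ‖ξ‖) ^ 2 * ‖F ξ‖ ^ 2

theorem FiniteEnergy.integrable_one {s : ℝ} (hs : 0 < s) {F : R5 → ℂ} (hF : FiniteEnergy s F) :
    Integrable fun ξ => phi s (2 * Real.pi * ‖ξ‖) ^ 1 * ‖F ξ‖ ^ 2 := by
  have hc := continuous_phi s
  refine (hF.2.const_mul s⁻¹).mono ?_ (ae_of_all _ fun ξ => ?_)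
  · exact (by fun_prop : Continuous fun ξ : R5 =>
      phi s (2 * Real.pi * ‖ξ‖) ^ 1).aestronglyMeasurable.mul (hF.1.norm.pow 2)
  · have h1 := phi_pos hs (2 * Real.pi * ‖ξ‖)
    have h2 := le_phi s (2 * Real.pi * ‖ξ‖)
    rw [Real.norm_of_nonneg (by positivity), Real.norm_of_nonneg (by positivity), ← mul_assoc]
    refine mul_le_mul_of_nonneg_right ?_ (by positivity)
    rw [inv_mul_eq_div, le_div_iff₀ hs]
    nlinarith

theorem FiniteEnergy.indicator {s : ℝ} {F : R5 → ℂ} (hF : FiniteEnergy s F) {S : Set R5}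
    (hS : MeasurableSet S) : FiniteEnergy s (S.indicator F) := by
  refine ⟨hF.1.indicator hS, (hF.2.indicator hS).congr (ae_of_all _ fun ξ => ?_)⟩
  by_cases h : ξ ∈ S <;> simp [h]

theorem moment_nonneg {s : ℝ} (hs : 0 < s) (k : ℕ) (F : R5 → ℂ) : 0 ≤ moment s k F :=
  integral_nonneg fun ξ => by have := phi_pos hs (2 * Real.pi * ‖ξ‖); positivity

theorem moment_indicator_add_compl {s : ℝ} {k : ℕ} {F : R5 → ℂ}
    (h : Integrable fun ξ => phi s (2 * Real.pi * ‖ξ‖) ^ k * ‖F ξ‖ ^ 2) {S : Set R5}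
    (hS : MeasurableSet S) :
    moment s k (S.indicator F) + moment s k (Sᶜ.indicator F) = moment s k F := by
  have e : ∀ S : Set R5, MeasurableSet S → moment s k (S.indicator F) =
      ∫ ξ in S, phi s (2 * Real.pi * ‖ξ‖) ^ k * ‖F ξ‖ ^ 2 := by
    intro S hS
    rw [moment, ← integral_indicator hS]
    refine integral_congr_ae (ae_of_all _ fun ξ => ?_)
    by_cases h : ξ ∈ S <;> simp [h]
  rw [e S hS, e _ hS.compl, integral_add_compl hS h]
  rfl

/-- If `φ_s ≥ c` on the support of `F`, then `c ∫ φ_s |F|² ≤ ∫ φ_s² |F|²`. -/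
theorem mul_moment_one_le {s : ℝ} (hs : 0 < s) {F : R5 → ℂ} (hF : FiniteEnergy s F) {c : ℝ}
    (hc : ∀ ξ, F ξ ≠ 0 → c ≤ phi s (2 * Real.pi * ‖ξ‖)) :
    c * moment s 1 F ≤ moment s 2 F := by
  unfold moment
  rw [← integral_const_mul]
  refine integral_mono ((hF.integrable_one hs).const_mul c) hF.2 fun ξ => ?_
  simp only
  by_cases h : F ξ = 0
  · simp [h]
  · have h1 := phi_pos hs (2 * Real.pi * ‖ξ‖)
    rw [← mul_assoc]
    refine mul_le_mul_of_nonneg_right ?_ (by positivity)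
    nlinarith [hc ξ h]

/-- The kernel splits into products. The inner-product term integrates to the squared length of the
momentum vector `∫ 2πξ φ_s|F|²` and enters with a minus sign, so it is dropped. -/
theorem pairEnergy_le {s : ℝ} (hs : 0 < s) {F : R5 → ℂ} (hF : FiniteEnergy s F) :
    pairEnergy s F ≤ ENNReal.ofReal (moment s 2 F ^ 2 - s ^ 2 * moment s 1 F ^ 2) := by
  have hcont := continuous_phi s
  set d : R5 → ℝ := fun ξ => phi s (2 * Real.pi * ‖ξ‖) ^ 1 * ‖F ξ‖ ^ 2 with hd
  have hd1 : Integrable d := hF.integrable_one hs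
  have hd2 : Integrable fun ξ => phi s (2 * Real.pi * ‖ξ‖) * d ξ := by
    refine hF.2.congr (ae_of_all _ fun ξ => ?_)
    simp only [hd]; ring
  have hdi : ∀ i : Fin 5, Integrable fun ξ : R5 => ξ i * d ξ := by
    intro i
    refine hd2.mono ?_ (ae_of_all _ fun ξ => ?_)
    · exact (by fun_prop : Continuous fun ξ : R5 => ξ i).aestronglyMeasurable.mul hd1.1
    · rw [norm_mul (ξ i), norm_mul _ (d ξ)]
      refine mul_le_mul_of_nonneg_right ?_ (norm_nonneg (d ξ))
      refine (PiLp.norm_apply_le ξ i).trans ?_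
      rw [Real.norm_of_nonneg (phi_pos hs _).le]
      refine Real.le_sqrt_of_sq_le ?_
      have h1 : 1 ≤ 2 * Real.pi := by linarith [Real.pi_gt_three]
      have h2 : ‖ξ‖ ≤ 2 * Real.pi * ‖ξ‖ := le_mul_of_one_le_left (norm_nonneg _) h1
      have h3 : ‖ξ‖ ^ 2 ≤ (2 * Real.pi * ‖ξ‖) ^ 2 := by gcongr
      nlinarith [sq_nonneg s]
  have hexp : ∀ q : R5 × R5, energyKernel s q * (‖F q.1‖ ^ 2 * ‖F q.2‖ ^ 2) =
      (phi s (2 * Real.pi * ‖q.1‖) * d q.1) * (phi s (2 * Real.pi * ‖q.2‖) * d q.2)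
        - 4 * Real.pi ^ 2 * ∑ i : Fin 5, (q.1 i * d q.1) * (q.2 i * d q.2)
        - s ^ 2 * (d q.1 * d q.2) := by
    intro q
    have : ∑ i : Fin 5, (q.1 i * d q.1) * (q.2 i * d q.2) = inner ℝ q.1 q.2 * (d q.1 * d q.2) := by
      rw [PiLp.inner_apply, Finset.sum_mul]
      refine Finset.sum_congr rfl fun i _ => ?_
      simp only [RCLike.inner_apply, conj_trivial]
      ring
    rw [this, energyKernel, massExcess]
    simp only [hd]
    ring
  have hi2 : Integrable (fun q : R5 × R5 =>
      4 * Real.pi ^ 2 * ∑ i : Fin 5, (q.1 i * d q.1) * (q.2 i * d q.2)) volume :=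
    (integrable_finsetSum _ fun i _ => (hdi i).mul_prod (hdi i)).const_mul _
  have hi1 : Integrable (fun q : R5 × R5 => (phi s (2 * Real.pi * ‖q.1‖) * d q.1) *
      (phi s (2 * Real.pi * ‖q.2‖) * d q.2)) volume := hd2.mul_prod hd2
  have hi3 : Integrable (fun q : R5 × R5 => s ^ 2 * (d q.1 * d q.2)) volume :=
    (hd1.mul_prod hd1).const_mul _
  have hint : Integrable (fun q : R5 × R5 => energyKernel s q * (‖F q.1‖ ^ 2 * ‖F q.2‖ ^ 2))
      volume := by
    simp_rw [hexp]
    exact (hi1.sub hi2).sub hi3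
  have hle : ∫ q : R5 × R5, energyKernel s q * (‖F q.1‖ ^ 2 * ‖F q.2‖ ^ 2) ≤
      moment s 2 F ^ 2 - s ^ 2 * moment s 1 F ^ 2 := by
    simp_rw [hexp]
    have hi12 : Integrable (fun q : R5 × R5 => (phi s (2 * Real.pi * ‖q.1‖) * d q.1) *
        (phi s (2 * Real.pi * ‖q.2‖) * d q.2) -
        4 * Real.pi ^ 2 * ∑ i : Fin 5, (q.1 i * d q.1) * (q.2 i * d q.2)) volume := hi1.sub hi2
    rw [integral_sub hi12 hi3, integral_sub hi1 hi2, integral_const_mul,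
      integral_const_mul, Measure.volume_eq_prod, integral_prod_mul d d,
      integral_prod_mul (fun y : R5 => phi s (2 * Real.pi * ‖y‖) * d y)
        (fun z : R5 => phi s (2 * Real.pi * ‖z‖) * d z),
      integral_finsetSum _ fun i _ => (hdi i).mul_prod (hdi i)]
    have e1 : ∫ ξ, phi s (2 * Real.pi * ‖ξ‖) * d ξ = moment s 2 F := by
      refine integral_congr_ae (ae_of_all _ fun ξ => ?_)
      simp only [hd]; ring
    have e2 : ∫ ξ, d ξ = moment s 1 F := rfl
    have e3 : 0 ≤ ∑ i : Fin 5, ∫ q : R5 × R5, (q.1 i * d q.1) * (q.2 i * d q.2)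
        ∂(volume.prod volume) := by
      refine Finset.sum_nonneg fun i _ => ?_
      rw [integral_prod_mul (fun ξ : R5 => ξ i * d ξ) (fun ξ : R5 => ξ i * d ξ)]
      exact mul_self_nonneg _
    rw [e1, e2]
    have : 0 ≤ 4 * Real.pi ^ 2 := by positivity
    nlinarith [mul_nonneg this e3]
  refine le_trans (le_of_eq ?_) (ENNReal.ofReal_le_ofReal hle)
  rw [ofReal_integral_eq_lintegral_ofReal hint (ae_of_all _ fun q => by
    have := energyKernel_nonneg hs q
    positivity), pairEnergy]
  refine lintegral_congr fun q => ?_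
  rw [ENNReal.ofReal_mul (energyKernel_nonneg hs q), ENNReal.ofReal_mul (by positivity),
    ENNReal.ofReal_pow (norm_nonneg _), ENNReal.ofReal_pow (norm_nonneg _), ofReal_norm,
    ofReal_norm, mul_comm]

end Energy

/-! ### Translation of the operator norms into moments -/

section Norms

theorem lintegral_enorm_sq_eq_ofReal {α : Type*} [MeasurableSpace α] {μ : Measure α} {F : α → ℂ}
    (hF : MemLp F 2 μ) : ∫⁻ x, ‖F x‖ₑ ^ 2 ∂μ = ENNReal.ofReal (∫ x, ‖F x‖ ^ 2 ∂μ) := by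
  rw [ofReal_integral_eq_lintegral_ofReal (hF.integrable_norm_pow (by norm_num))
    (ae_of_all _ fun x => by positivity)]
  refine lintegral_congr fun x => ?_
  rw [ENNReal.ofReal_pow (norm_nonneg _), ofReal_norm]

theorem norm_funcSqrtLaplacian_sq {m : ℝ → ℂ} {f : L2} (h : InDomain m f) :
    ‖funcSqrtLaplacian m f‖ ^ 2 = ∫ ξ, ‖symbolMul m f ξ‖ ^ 2 := by
  have h1 : ‖funcSqrtLaplacian m f‖ₑ ^ 2 = ENNReal.ofReal (∫ ξ, ‖symbolMul m f ξ‖ ^ 2) := by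
    rw [norm_sq_eq_lintegral, ← lintegral_enorm_sq_eq_ofReal h]
    refine lintegral_congr_ae ?_
    filter_upwards [fourier_funcSqrtLaplacian h] with ξ hξ
    rw [hξ]
  rw [← ofReal_norm, ← ENNReal.ofReal_pow (norm_nonneg _)] at h1
  exact (ENNReal.ofReal_eq_ofReal_iff (by positivity)
    (integral_nonneg fun ξ => by positivity)).1 h1

theorem finiteEnergy_of_inDomain {s : ℝ} {f : L2} (h : InDomain (fun r => (phi s r : ℂ)) f) :
    FiniteEnergy s (𝓕 f : L2) := by
  refine ⟨Lp.aestronglyMeasurable _, (h.integrable_norm_pow (by norm_num)).congr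
    (ae_of_all _ fun ξ => ?_)⟩
  simp [symbolMul, mul_pow]

theorem norm_phiOp_sq {s : ℝ} {f : L2} (h : InDomain (fun r => (phi s r : ℂ)) f) :
    ‖phiOp s f‖ ^ 2 = moment s 2 (𝓕 f : L2) := by
  rw [phiOp, norm_funcSqrtLaplacian_sq h]
  refine integral_congr_ae (ae_of_all _ fun ξ => ?_)
  simp [symbolMul, mul_pow]

theorem norm_sqrtSymbol_sq {s : ℝ} (hs : 0 < s) (r : ℝ) :
    ‖((phi s r ^ (1 / 2 : ℝ) : ℝ) : ℂ)‖ ^ 2 = phi s r := by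
  have h := phi_pos hs r
  rw [Complex.norm_real, Real.norm_of_nonneg (by positivity), ← Real.rpow_natCast,
    ← Real.rpow_mul h.le]
  norm_num

theorem inDomain_sqrt {s : ℝ} (hs : 0 < s) {f : L2} (h : InDomain (fun r => (phi s r : ℂ)) f) :
    InDomain (fun r => ((phi s r ^ (1 / 2 : ℝ) : ℝ) : ℂ)) f := by
  have hc := continuous_phi s
  have hm : AEStronglyMeasurable
      (symbolMul (fun r => ((phi s r ^ (1 / 2 : ℝ) : ℝ) : ℂ)) f) volume := by
    refine Continuous.aestronglyMeasurable ?_ |>.mul (Lp.aestronglyMeasurable _)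
    have : Continuous fun ξ : R5 => phi s (2 * Real.pi * ‖ξ‖) ^ (1 / 2 : ℝ) :=
      Continuous.rpow_const (by fun_prop) fun _ => Or.inr (by norm_num)
    exact Complex.continuous_ofReal.comp this
  refine (memLp_two_iff_integrable_sq_norm hm).2 ?_
  refine ((finiteEnergy_of_inDomain h).integrable_one hs).congr (ae_of_all _ fun ξ => ?_)
  simp only [symbolMul, norm_mul, mul_pow, norm_sqrtSymbol_sq hs, pow_one]

theorem norm_phiHalfOp_sq {s : ℝ} (hs : 0 < s) {f : L2}
    (h : InDomain (fun r => (phi s r : ℂ)) f) :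
    ‖phiHalfOp s f‖ ^ 2 = moment s 1 (𝓕 f : L2) := by
  rw [phiHalfOp, norm_funcSqrtLaplacian_sq (inDomain_sqrt hs h)]
  refine integral_congr_ae (ae_of_all _ fun ξ => ?_)
  simp only [symbolMul, norm_mul, mul_pow, norm_sqrtSymbol_sq hs, pow_one]

theorem moment_sub_le_one {s : ℝ} (hs : 0 < s) {f : L2}
    (h : InDomain (fun r => (phi s r : ℂ)) f) (h1 : sNorm s f ≤ 1) :
    moment s 2 (𝓕 f : L2) ^ 2 - s ^ 2 * moment s 1 (𝓕 f : L2) ^ 2 ≤ 1 := by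
  have h2 := mul_moment_one_le hs (finiteEnergy_of_inDomain h) (c := s) fun ξ _ => le_phi s _
  have h3 := moment_nonneg hs 1 (𝓕 f : L2)
  have e : sNorm s f = (moment s 2 (𝓕 f : L2) ^ 2 - s ^ 2 * moment s 1 (𝓕 f : L2) ^ 2) ^
      (1 / 4 : ℝ) := by
    rw [sNorm, ← norm_phiOp_sq h, ← norm_phiHalfOp_sq hs h, ← pow_mul, ← pow_mul]
  rw [e] at h1
  have h0 : 0 ≤ moment s 2 (𝓕 f : L2) ^ 2 - s ^ 2 * moment s 1 (𝓕 f : L2) ^ 2 := by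
    rw [← mul_pow, sub_nonneg]
    exact pow_le_pow_left₀ (mul_nonneg hs.le h3) h2 2
  by_contra hlt
  exact absurd h1 (not_le.2 (Real.one_lt_rpow (not_le.1 hlt) (by norm_num)))

/-- On the ball `φ_s² ≤ φ_s(R) φ_s`, so local energy is controlled by the half-order moment; `(2π)⁵`
is the Jacobian of the change of Fourier normalisation. -/
theorem eLpNorm_hat_ball_sq_le {s : ℝ} (hs : 0 < s) {f : L2}
    (h : InDomain (fun r => (phi s r : ℂ)) f) (R : ℝ) :
    eLpNorm (hat (phiOp s f)) 2 (volume.restrict (Metric.ball (0 : R5) R)) ^ 2 ≤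
      ENNReal.ofReal ((2 * Real.pi) ^ 5 * (phi s R * moment s 1 (𝓕 f : L2))) := by
  have hpi : 0 < 2 * Real.pi := by positivity
  have hfe := finiteEnergy_of_inDomain h
  set U : L2 := 𝓕 (phiOp s f) with hU
  have hUF : (U : R5 → ℂ) =ᵐ[volume] symbolMul (fun r => (phi s r : ℂ)) f :=
    fourier_funcSqrtLaplacian h
  have hball := Metric.isOpen_ball (x := (0 : R5)) (ε := R) |>.measurableSet
  have key : eLpNorm (hat (phiOp s f)) 2 (volume.restrict (Metric.ball (0 : R5) R)) ^ 2 =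
      ∫⁻ ξ in Metric.ball (0 : R5) R, ‖U ((2 * Real.pi)⁻¹ • ξ)‖ₑ ^ 2 := by
    have := eLpNorm_nnreal_pow_eq_lintegral (f := hat (phiOp s f))
      (μ := volume.restrict (Metric.ball (0 : R5) R)) (p := 2) (by norm_num)
    simp only [NNReal.coe_ofNat, ENNReal.coe_ofNat, ENNReal.rpow_ofNat] at this
    exact this
  set G : R5 → ℝ≥0∞ := fun η =>
    (Metric.ball (0 : R5) R).indicator (fun _ => ‖U η‖ₑ ^ 2) ((2 * Real.pi) • η) with hG
  have hUm : AEMeasurable (fun η => ‖U η‖ₑ ^ 2) volume :=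
    (Lp.aestronglyMeasurable U).enorm.pow_const 2
  have hGe : G = ((fun η : R5 => (2 * Real.pi) • η) ⁻¹' Metric.ball 0 R).indicator
      fun η => ‖U η‖ₑ ^ 2 := rfl
  have hGm : AEMeasurable G volume := by
    rw [hGe]
    exact hUm.indicator (measurable_const_smul (2 * Real.pi) hball)
  have hmap := Measure.map_addHaar_smul (volume : Measure R5) (inv_ne_zero hpi.ne')
  rw [key, ← lintegral_indicator hball]
  have e1 : ∀ ξ : R5, (Metric.ball (0 : R5) R).indicator
      (fun ξ => ‖U ((2 * Real.pi)⁻¹ • ξ)‖ₑ ^ 2) ξ = G ((2 * Real.pi)⁻¹ • ξ) := by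
    intro ξ
    simp only [hG]
    rw [smul_inv_smul₀ hpi.ne']
    rfl
  simp_rw [e1]
  rw [← lintegral_map' (f := G) (g := fun ξ : R5 => (2 * Real.pi)⁻¹ • ξ)
    (by rw [hmap]; exact hGm.smul_measure _) (measurable_const_smul _).aemeasurable, hmap,
    lintegral_smul_measure]
  have hconst : ENNReal.ofReal |(((2 * Real.pi)⁻¹) ^ Module.finrank ℝ R5)⁻¹| =
      ENNReal.ofReal ((2 * Real.pi) ^ 5) := by
    congr 1
    simp only [finrank_euclideanSpace, Fintype.card_fin, inv_pow, inv_inv]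
    exact abs_of_nonneg (by positivity)
  rw [hconst, ENNReal.ofReal_mul (by positivity), smul_eq_mul]
  gcongr
  have hint := hfe.integrable_one hs
  rw [moment, ← integral_const_mul, ofReal_integral_eq_lintegral_ofReal (hint.const_mul _)
    (ae_of_all _ fun ξ => by
      have h1 := phi_pos hs (2 * Real.pi * ‖ξ‖)
      have h2 := phi_pos hs R
      positivity)]
  refine lintegral_mono_ae ?_
  filter_upwards [hUF] with η hη
  simp only [hG]
  by_cases hb : (2 * Real.pi) • η ∈ Metric.ball (0 : R5) R
  · rw [Set.indicator_of_mem hb, hη, ← ofReal_norm, ← ENNReal.ofReal_pow (norm_nonneg _)]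
    refine ENNReal.ofReal_le_ofReal ?_
    have h1 := phi_pos hs (2 * Real.pi * ‖η‖)
    have h2 : phi s (2 * Real.pi * ‖η‖) ≤ phi s R := by
      rw [mem_ball_zero_iff, norm_smul, Real.norm_of_nonneg hpi.le] at hb
      have := norm_nonneg η
      unfold phi
      gcongr
    simp only [symbolMul, norm_mul, mul_pow, Complex.norm_real, Real.norm_of_nonneg h1.le, pow_one]
    rw [← mul_assoc]
    refine mul_le_mul_of_nonneg_right ?_ (by positivity)
    nlinarith
  · rw [Set.indicator_of_notMem hb]
    exact zero_le

end Norms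

/-! ### Escape of a maximising sequence to high frequencies -/

section Concentration

/-- If almost all the energy lies where `φ_s ≥ s / κ`, the total mass is small. -/
theorem mass_le {s κ l p mL mH : ℝ} (hs : 0 < s) (hκ : 0 < κ) (hκ2 : κ ≤ 1 / 2)
    (hmL : 0 ≤ mL) (hmH : 0 ≤ mH) (hl : s * mL ≤ l) (hp : s / κ * mH ≤ p) (hp1 : 1 - κ ≤ p)
    (h : (l + p) ^ 2 - s ^ 2 * (mL + mH) ^ 2 ≤ 1) : mL + mH ≤ 8 * κ / s := by
  have hH : s * mH ≤ κ * p := by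
    rw [div_mul_eq_mul_div, div_le_iff₀ hκ] at hp
    linarith
  set x := s * mL with hx
  set y := s * mH with hy
  have hx0 : 0 ≤ x := by positivity
  have hy0 : 0 ≤ y := by positivity
  have hp0 : 0 < p := by linarith
  -- In `(x + p)² - (x + y)²` the squares of `x` cancel and `y ≤ κp`; the surviving cross term `2xp`
  -- is what controls the low mass.
  have h1 : p ^ 2 * (1 - κ ^ 2) + 2 * x * p * (1 - κ) ≤ 1 := by
    have e1 : (x + p) ^ 2 ≤ (l + p) ^ 2 := by gcongr
    have e2 : y ^ 2 ≤ (κ * p) ^ 2 := by gcongr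
    have e3 : x * y ≤ x * (κ * p) := by gcongr
    have e4 : s ^ 2 * (mL + mH) ^ 2 = (x + y) ^ 2 := by rw [hx, hy]; ring
    nlinarith
  have hxp : 0 ≤ 2 * x * p * (1 - κ) := by
    have : 0 ≤ 1 - κ := by linarith
    positivity
  have hκsq : κ ^ 2 ≤ 1 / 4 := by nlinarith
  have hp2 : p ≤ 2 := by nlinarith
  have hyb : y ≤ 2 * κ := by nlinarith
  -- Here `p²(1 - κ²) ≥ 1 - 2κ` leaves at most `2κ` for `2xp(1 - κ)`, while `p(1 - κ) ≥ 1/4`.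
  have hxb : x ≤ 4 * κ := by
    have e1 : (1 - κ) ^ 2 ≤ p ^ 2 := by
      have : 0 ≤ 1 - κ := by linarith
      gcongr
    have e2 : 1 / 4 ≤ p * (1 - κ) := by nlinarith
    have e3 : x * (1 / 4) ≤ x * (p * (1 - κ)) := by gcongr
    have e4 : (1 - κ) ^ 2 * (1 - κ ^ 2) ≤ p ^ 2 * (1 - κ ^ 2) := by
      refine mul_le_mul_of_nonneg_right e1 (by linarith)
    have e5 : 1 - 2 * κ ≤ (1 - κ) ^ 2 * (1 - κ ^ 2) := by
      have : 0 ≤ κ ^ 3 * (2 - κ) := by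
        have : 0 ≤ 2 - κ := by linarith
        positivity
      nlinarith
    nlinarith
  rw [le_div_iff₀ hs]
  have : (mL + mH) * s = x + y := by rw [hx, hy]; ring
  linarith

theorem ofReal_sharpConst_pow : ENNReal.ofReal sharpConst ^ 4 =
    ENNReal.ofReal (1 / (24 * Real.pi ^ 2)) := by
  rw [← ENNReal.ofReal_pow (by unfold sharpConst; positivity), sharpConst, ← Real.rpow_natCast,
    ← Real.rpow_mul (by positivity)]
  norm_num

theorem spaceTimeFour_eq_pow (s : ℝ) (f : L2) : spaceTimeFour s f = spaceTimeL4 s f ^ 4 := by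
  rw [spaceTimeL4_eq, ← ENNReal.rpow_natCast, ← ENNReal.rpow_mul]
  norm_num

/-- The bounded-frequency part of a maximising sequence tends to zero in space-time norm. -/
theorem tendsto_spaceTimeL4_low {s : ℝ} (hs : 0 < s) {g : ℕ → L2}
    (hg : IsMaximisingSequence s g) {R : ℝ}
    (hS : MeasurableSet (Metric.closedBall (0 : R5) R)) :
    Tendsto (fun n => spaceTimeL4 s (freqRestrict hS (g n))) atTop (𝓝 0) := by
  obtain ⟨hdom, hnorm, hlim⟩ := hg
  set C := ENNReal.ofReal (1 / (24 * Real.pi ^ 2)) with hC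
  obtain ⟨θ, hθ, h⟩ := exists_spaceTimeFour_add_le hs R
  have hle : ∀ n, spaceTimeFour s (g n) + ENNReal.ofReal θ *
      pairEnergy s ((Metric.closedBall (0 : R5) R).indicator (𝓕 (g n) : L2)) ≤ C := by
    intro n
    refine (h (g n)).trans ?_
    refine mul_le_of_le_one_right' ?_
    refine (pairEnergy_le hs (finiteEnergy_of_inDomain (hdom n))).trans ?_
    rw [← ENNReal.ofReal_one]
    exact ENNReal.ofReal_le_ofReal (moment_sub_le_one hs (hdom n) (hnorm n))
  have hT : Tendsto (fun n => C - spaceTimeFour s (g n)) atTop (𝓝 0) := by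
    have h1 : Tendsto (fun n => spaceTimeFour s (g n)) atTop (𝓝 C) := by
      simp_rw [spaceTimeFour_eq_pow]
      rw [hC, ← ofReal_sharpConst_pow]
      exact ((ENNReal.continuous_pow 4).tendsto _).comp hlim
    have h2 := ENNReal.Tendsto.sub (tendsto_const_nhds (x := C)) h1 (Or.inl ENNReal.ofReal_ne_top)
    simpa using h2
  have hθ0 : ENNReal.ofReal θ ≠ 0 := by simpa using hθ
  -- The low-frequency pair energy is at most the deficit in the sharp inequality divided by `θ`,
  -- and it bounds the space-time norm of the low part.
  have hup : ∀ n, spaceTimeFour s (freqRestrict hS (g n)) ≤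
      C / ENNReal.ofReal θ * (C - spaceTimeFour s (g n)) := by
    intro n
    refine (spaceTimeFour_le_pairEnergy hs (fourier_freqRestrict hS (g n))).trans ?_
    rw [ENNReal.mul_comm_div]
    gcongr
    rw [ENNReal.le_div_iff_mul_le (Or.inl hθ0) (Or.inl ENNReal.ofReal_ne_top), mul_comm]
    refine ENNReal.le_sub_of_add_le_left ?_ (hle n)
    exact ne_top_of_le_ne_top ENNReal.ofReal_ne_top (le_self_add.trans (hle n))
  have h0 : Tendsto (fun n => spaceTimeFour s (freqRestrict hS (g n))) atTop (𝓝 0) := by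
    refine tendsto_of_tendsto_of_tendsto_of_le_of_le tendsto_const_nhds ?_ (fun _ => zero_le) hup
    have := ENNReal.Tendsto.const_mul hT
      (Or.inr (ENNReal.div_ne_top (x := C) ENNReal.ofReal_ne_top hθ0))
    simpa using this
  simp_rw [spaceTimeL4_eq]
  have := ((ENNReal.continuous_rpow_const (y := 1 / 4)).tendsto 0).comp h0
  simpa [Function.comp_def] using this

theorem eventually_mass_le {s : ℝ} (hs : 0 < s) {g : ℕ → L2} (hg : IsMaximisingSequence s g)
    {κ : ℝ} (hκ : 0 < κ) (hκ2 : κ ≤ 1 / 2) :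
    ∀ᶠ n in atTop, moment s 1 (𝓕 (g n) : L2) ≤ 8 * κ / s := by
  -- Outside this ball `φ_s(2π|ξ|) ≥ s/κ`, so the high-frequency mass is at most `κ/s` times its
  -- energy.
  set R := s / κ / (2 * Real.pi) with hR
  have hS : MeasurableSet (Metric.closedBall (0 : R5) R) := Metric.isClosed_closedBall.measurableSet
  have hlow := tendsto_spaceTimeL4_low hs hg hS
  obtain ⟨hdom, hnorm, hlim⟩ := hg
  have hc0 : 0 < sharpConst := by
    have := Real.pi_pos
    unfold sharpConst; positivity
  set c := ENNReal.ofReal sharpConst with hc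
  -- The threshold `√(1 - κ)` becomes `(1 - κ)²` after the fourth power, to be compared with the
  -- square of the high-frequency energy.
  have hev : ∀ᶠ n in atTop, c * ENNReal.ofReal (√(1 - κ)) + spaceTimeL4 s (freqRestrict hS (g n))
      < spaceTimeL4 s (g n) := by
    have h1 : Tendsto (fun n => c * ENNReal.ofReal (√(1 - κ)) +
        spaceTimeL4 s (freqRestrict hS (g n))) atTop (𝓝 (c * ENNReal.ofReal (√(1 - κ)) + 0)) :=
      tendsto_const_nhds.add hlow
    refine h1.eventually_lt hlim ?_
    rw [add_zero, hc, ← ENNReal.ofReal_mul hc0.le]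
    refine (ENNReal.ofReal_lt_ofReal_iff hc0).2 ?_
    refine mul_lt_of_lt_one_right hc0 ?_
    rw [Real.sqrt_lt' one_pos]
    linarith
  filter_upwards [hev] with n hn
  have hfe := finiteEnergy_of_inDomain (hdom n)
  set F : R5 → ℂ := ((𝓕 (g n) : L2) : R5 → ℂ) with hF
  set FL := (Metric.closedBall (0 : R5) R).indicator F with hFL
  set FH := (Metric.closedBall (0 : R5) R)ᶜ.indicator F with hFH
  have hL : FiniteEnergy s FL := hfe.indicator hS
  have hH : FiniteEnergy s FH := hfe.indicator hS.compl
  have hm1 : moment s 1 FL + moment s 1 FH = moment s 1 F :=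
    moment_indicator_add_compl (hfe.integrable_one hs) hS
  have hm2 : moment s 2 FL + moment s 2 FH = moment s 2 F := moment_indicator_add_compl hfe.2 hS
  have hp : 1 - κ ≤ moment s 2 FH := by
    have h1 : spaceTimeL4 s (g n) ≤ spaceTimeL4 s (freqRestrict hS (g n)) +
        spaceTimeL4 s (freqRestrict hS.compl (g n)) := by
      conv_lhs => rw [← freqRestrict_add_compl hS (g n)]
      exact spaceTimeL4_add_le s _ _
    have h2 : c * ENNReal.ofReal (√(1 - κ)) < spaceTimeL4 s (freqRestrict hS.compl (g n)) := by
      have := hn.trans_le h1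
      rw [add_comm] at this
      exact lt_of_add_lt_add_left this
    have h3 : spaceTimeL4 s (freqRestrict hS.compl (g n)) ^ 4 ≤
        c ^ 4 * ENNReal.ofReal (moment s 2 FH ^ 2) := by
      rw [← spaceTimeFour_eq_pow, hc, ofReal_sharpConst_pow]
      refine (spaceTimeFour_le_pairEnergy hs (fourier_freqRestrict hS.compl (g n))).trans ?_
      gcongr
      refine (pairEnergy_le hs hH).trans (ENNReal.ofReal_le_ofReal ?_)
      have : 0 ≤ s ^ 2 * moment s 1 FH ^ 2 := by positivity
      linarith
    have h4 := (pow_le_pow_left' h2.le 4).trans h3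
    rw [mul_pow] at h4
    have hc1 : c ^ 4 ≠ 0 := by
      simpa [hc] using hc0
    have hc2 : c ^ 4 ≠ ∞ := ENNReal.pow_ne_top ENNReal.ofReal_ne_top
    have h5 := (ENNReal.mul_le_mul_iff_right hc1 hc2).1 h4
    rw [← ENNReal.ofReal_pow (Real.sqrt_nonneg _), ENNReal.ofReal_le_ofReal_iff (by positivity),
      show √(1 - κ) ^ 4 = (√(1 - κ) ^ 2) ^ 2 by ring, Real.sq_sqrt (by linarith)] at h5
    exact le_of_sq_le_sq h5 (moment_nonneg hs 2 FH)
  rw [← hm1]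
  refine mass_le hs hκ hκ2 (moment_nonneg hs 1 _) (moment_nonneg hs 1 _)
    (mul_moment_one_le hs hL fun ξ _ => le_phi s _) (mul_moment_one_le hs hH fun ξ hξ => ?_) hp ?_
  · have hξ' : ξ ∉ Metric.closedBall (0 : R5) R := fun hmem => hξ (by simp [hFH, hmem])
    rw [mem_closedBall_zero_iff, not_le, hR, div_lt_iff₀ (by positivity)] at hξ'
    refine Real.le_sqrt_of_sq_le ?_
    have : (s / κ) ^ 2 ≤ (2 * Real.pi * ‖ξ‖) ^ 2 := by
      have : 0 < s / κ := by positivity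
      gcongr
      linarith
    nlinarith [sq_nonneg s]
  · rw [hm1, hm2]
    exact moment_sub_le_one hs (hdom n) (hnorm n)

end Concentration

end KleinGordon

/-! ### Conclusion -/

theorem proposition1 (s : ℝ) (hs : 0 < s) (g : ℕ → KleinGordon.L2)
    (hg : KleinGordon.IsMaximisingSequence s g) :
    ∀ ε R : ℝ, 0 < ε → 0 < R → ∃ N : ℕ, ∀ n : ℕ, N ≤ n →
      ‖KleinGordon.phiHalfOp s (g n)‖ < ε ∧
      eLpNorm (KleinGordon.hat (KleinGordon.phiOp s (g n))) 2
        (volume.restrict (Metric.ball (0 : KleinGordon.R5) R)) < ENNReal.ofReal ε := by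
  intro ε R hε _
  -- One constant serves both claims: `1` for the half-order norm, the other summand for the local
  -- energy.
  set D : ℝ := 1 + (2 * Real.pi) ^ 5 * KleinGordon.phi s R with hD
  have hφ := KleinGordon.phi_pos hs R
  have hD1 : 1 ≤ D := by
    have : 0 ≤ (2 * Real.pi) ^ 5 * KleinGordon.phi s R := by positivity
    linarith
  have hD0 : 0 < D := by linarith
  obtain ⟨κ, hκ, hκ1, hκ2⟩ : ∃ κ : ℝ, 0 < κ ∧ κ ≤ 1 / 2 ∧ D * (8 * κ / s) < ε ^ 2 := by
    -- The second entry makes `D · 8κ/s` at most `ε²/2`.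
    refine ⟨min (1 / 2) (s * ε ^ 2 / (16 * D)), by positivity, min_le_left _ _, ?_⟩
    have h := min_le_right (1 / 2) (s * ε ^ 2 / (16 * D))
    calc _ ≤ D * (8 * (s * ε ^ 2 / (16 * D)) / s) := by gcongr
      _ = ε ^ 2 / 2 := by field_simp; norm_num
      _ < ε ^ 2 := half_lt_self (by positivity)
  obtain ⟨N, hN⟩ := eventually_atTop.1 (KleinGordon.eventually_mass_le hs hg hκ hκ1)
  refine ⟨N, fun n hn => ?_⟩
  have hm := hN n hn
  have hdom := hg.1 n
  set m := KleinGordon.moment s 1 (𝓕 (g n) : KleinGordon.L2) with hmdef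
  have hm0 : 0 ≤ m := KleinGordon.moment_nonneg hs 1 _
  have hDm : D * m < ε ^ 2 := lt_of_le_of_lt (by gcongr) hκ2
  constructor
  · refine lt_of_pow_lt_pow_left₀ 2 hε.le ?_
    rw [KleinGordon.norm_phiHalfOp_sq hs hdom]
    nlinarith
  · refine lt_of_pow_lt_pow_left' 2 ?_
    refine (KleinGordon.eLpNorm_hat_ball_sq_le hs hdom R).trans_lt ?_
    rw [← ENNReal.ofReal_pow hε.le]
    refine (ENNReal.ofReal_lt_ofReal_iff (by positivity)).2 ?_
    have : D * m = m + (2 * Real.pi) ^ 5 * (KleinGordon.phi s R * m) := by rw [hD]; ring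
    linarith
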